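/- Let $\Omega\subset\mathbb{R}^2$ be an open planar polygon, that is, a bounded open set with $\Omega=\operatorname{int}\overline\Omega$ whose boundary is a simple closed polygonal chain with finitely many (at least three) vertices; $\Omega$ need not be convex. Let $n=(n_1,n_2)$ be its outward unit normal (defined on $\partial\Omega$ except at the vertices), let $m\ge 0$, and let $\gamma:W^{1,2}(\Omega;\mathbb{C}^2)\to L^2(\partial\Omega;\mathbb{C}^2)$ be the boundary trace, i.e. the extension by continuity of the restriction $\varphi\mapsto\varphi|_{\partial\Omega}$ of functions smooth up to the boundary, where $\partial\Omega$ carries arc length. Let $T$ be the Dirac operator with infinite-mass boundary conditions $$T=\begin{pmatrix} m & -i(\partial_1-i\partial_2)\\ -i(\partial_1+i\partial_2) & -m\end{pmatrix},\qquad \mathsf{D}(T)=\Big\{u=\begin{pmatrix}u_1\\u_2\end{pmatrix}\in W^{1,2}(\Omega;\mathbb{C}^2):\ u_2=i(n_1+in_2)u_1\ \text{a.e. on }\partial\Omega\text{ in the sense of traces}\Big\}.$$ Then for every $u\in\mathsf{D}(T)$, $$\|Tu\|^2_{L^2(\Omega)}=\|\nabla u\|^2_{L^2(\Omega)}+m^2\|u\|^2_{L^2(\Omega)}+m\,\|\gamma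 u\|^2_{L^2(\partial\Omega)},$$ where $\|\nabla u\|^2=\|\partial_1u\|^2+\|\partial_2u\|^2$. -/

import Mathlib

open MeasureTheory Filter Topology
open scoped ContDiff ENNReal

noncomputable section

namespace PolygonDirac

/-- The Euclidean plane. -/
abbrev Plane : Type := EuclideanSpace ℝ (Fin 2)

/-- The space `ℂ²` of spinor values, with its Hermitian norm. -/
abbrev Spinor : Type := EuclideanSpace ℂ (Fin 2)

/-! ### Polygons -/

/-- The `i`-th side of the closed polygonal chain with vertices `v`. -/
def side {n : ℕ} (v : ZMod n → Plane) (i : ZMod n) : Set Plane :=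
  segment ℝ (v i) (v (i + 1))

/-- A simple closed polygonal chain: at least three distinct vertices, consecutive sides meet only
at their common vertex, other pairs of distinct sides do not meet. -/
structure IsSimpleClosedChain {n : ℕ} (v : ZMod n → Plane) : Prop where
  three_le : 3 ≤ n
  injective : Function.Injective v
  consecutive : ∀ i, side v i ∩ side v (i + 1) = {v (i + 1)}
  disjoint : ∀ i j, j ≠ i → j ≠ i + 1 → i ≠ j + 1 → Disjoint (side v i) (side v j)

/-- An (open) planar polygon: a bounded open set whose boundary is a simple closed polygonal chain.
The condition `interior (closure Ω) = Ω` says that `Ω` lies on one side only of its boundary. -/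
def IsPolygon (Ω : Set Plane) : Prop :=
  IsOpen Ω ∧ Bornology.IsBounded Ω ∧ interior (closure Ω) = Ω ∧
    ∃ (n : ℕ) (v : ZMod n → Plane), IsSimpleClosedChain v ∧ frontier Ω = ⋃ i, side v i

/-- `ν` is the outward unit normal of `Ω` at the boundary point `x`, near which `Ω` is a half-disk.
On the boundary of a polygon it exists, and is unique, at every point interior to a side. -/
def IsOutwardUnitNormal (Ω : Set Plane) (x ν : Plane) : Prop :=
  ‖ν‖ = 1 ∧ ∃ r > 0, Ω ∩ Metric.ball x r = {y | inner ℝ (y - x) ν < 0} ∩ Metric.ball x r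

/-- Arc length on the boundary. -/
def boundaryMeasure (Ω : Set Plane) : Measure Plane :=
  (Measure.hausdorffMeasure 1).restrict (frontier Ω)

/-! ### The Sobolev space `W^{1,2}(Ω; ℂ²)` and boundary traces -/

/-- The classical partial derivative in the `j`-th coordinate direction. -/
def partialDeriv {E : Type*} [NormedAddCommGroup E] [NormedSpace ℝ E] (j : Fin 2)
    (f : Plane → E) (x : Plane) : E :=
  fderiv ℝ f x (EuclideanSpace.single j (1 : ℝ))

/-- `g` is a weak `j`-th partial derivative of `f` in `Ω`. -/
def HasWeakPartial (Ω : Set Plane) (j : Fin 2) (f g : Plane → Spinor) : Prop :=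
  ∀ φ : Plane → ℝ, ContDiff ℝ ∞ φ → HasCompactSupport φ → tsupport φ ⊆ Ω →
    ∫ x in Ω, partialDeriv j φ x • f x = - ∫ x in Ω, φ x • g x

/-- `u` has a weak `j`-th partial derivative which is square integrable in `Ω`. -/
def HasL2WeakPartial (Ω : Set Plane) (j : Fin 2) (u : Plane → Spinor) : Prop :=
  ∃ g : Plane → Spinor, MemLp g 2 (volume.restrict Ω) ∧ HasWeakPartial Ω j u g

/-- `u` belongs to `W^{1,2}(Ω; ℂ²)`. Only the values of `u` in `Ω` matter. -/
def MemW12 (Ω : Set Plane) (u : Plane → Spinor) : Prop :=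
  MemLp u 2 (volume.restrict Ω) ∧ ∀ j, HasL2WeakPartial Ω j u

open Classical in
/-- The weak partial derivative `∂ⱼ u` of `u ∈ W^{1,2}(Ω; ℂ²)`, determined almost everywhere in the
open set `Ω`. -/
def weakPartial (Ω : Set Plane) (j : Fin 2) (u : Plane → Spinor) : Plane → Spinor :=
  if h : HasL2WeakPartial Ω j u then h.choose else 0

/-- `g ∈ L²(∂Ω; ℂ²)` is the boundary trace `γu` of `u ∈ W^{1,2}(Ω; ℂ²)`: there are functions smooth
up to the boundary that converge to `u` in `W^{1,2}(Ω; ℂ²)` and whose restrictions to the boundary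
converge to `g` in `L²(∂Ω; ℂ²)`. -/
def IsTrace (Ω : Set Plane) (u g : Plane → Spinor) : Prop :=
  MemW12 Ω u ∧ MemLp g 2 (boundaryMeasure Ω) ∧
    ∃ φ : ℕ → Plane → Spinor, (∀ k, ContDiff ℝ ∞ (φ k)) ∧
      Tendsto (fun k => eLpNorm (fun x => φ k x - u x) 2 (volume.restrict Ω)) atTop (𝓝 0) ∧
      (∀ j, Tendsto (fun k => eLpNorm (fun x => partialDeriv j (φ k) x - weakPartial Ω j u x) 2
        (volume.restrict Ω)) atTop (𝓝 0)) ∧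
      Tendsto (fun k => eLpNorm (fun x => φ k x - g x) 2 (boundaryMeasure Ω)) atTop (𝓝 0)

/-! ### The Dirac operator with infinite-mass boundary conditions -/

/-- The infinite-mass boundary condition `g₂ = i (n₁ + i n₂) g₁` on the boundary of the polygon. -/
def InfiniteMassCondition (Ω : Set Plane) (g : Plane → Spinor) : Prop :=
  ∀ᵐ x ∂(boundaryMeasure Ω), ∀ ν : Plane, IsOutwardUnitNormal Ω x ν →
    g x 1 = Complex.I * ((ν 0 : ℂ) + Complex.I * (ν 1 : ℂ)) * g x 0

/-- The operator domain `D(T)`: the functions in `W^{1,2}(Ω; ℂ²)` whose boundary trace satisfies the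
infinite-mass condition. -/
def diracDomain (Ω : Set Plane) : Set (Plane → Spinor) :=
  {u | MemW12 Ω u ∧ ∃ g, IsTrace Ω u g ∧ InfiniteMassCondition Ω g}

/-- The action of the Dirac operator with mass `m`:
`(T u)₁ = m u₁ - i (∂₁ - i ∂₂) u₂` and `(T u)₂ = -i (∂₁ + i ∂₂) u₁ - m u₂`. -/
def dirac (Ω : Set Plane) (m : ℝ) (u : Plane → Spinor) (x : Plane) : Spinor :=
  !₂[(m : ℂ) * u x 0
      - Complex.I * (weakPartial Ω 0 u x 1 - Complex.I * weakPartial Ω 1 u x 1),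
    - Complex.I * (weakPartial Ω 0 u x 0 + Complex.I * weakPartial Ω 1 u x 0)
      - (m : ℂ) * u x 1]

/-- The squared norm of `f` in `L²(μ)`. -/
def normSqL2 (μ : Measure Plane) (f : Plane → Spinor) : ℝ :=
  ∫ x, ‖f x‖ ^ 2 ∂μ

end PolygonDirac

end

open MeasureTheory Filter Topology
open scoped ContDiff ENNReal

noncomputable section

namespace PolygonDirac

/-! ### Geometry of the boundary -/

/-! Expanding `|Tu|²` pointwise (`norm_dirac_sq`) gives `|∇u|² + m²|u|²` plus two cross terms. One
is `2m` times the real part of a divergence built from `conj u₁ · u₂`. The other is the imaginary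
part of the difference of the area forms `du₁ ∧ d(conj u₁)` and `du₂ ∧ d(conj u₂)`. The theorem
amounts to computing the integrals of these two. For the divergence, Gauss-Green produces the
boundary factor `-i n₁ - n₂`. Multiplied by the infinite-mass factor `i (n₁ + i n₂)` it gives `|n|²
= 1`, so the integral is `∫ |γu₁|²`, which is half of `‖γu‖²` since both components of the trace
have equal modulus (`integral_cauchyRiemann`). For the area forms, straightness of the sides is
essential. Along one side the normal is constant, so `u₂ = c u₁` there with a constant `c` of
modulus one. The area form is a null Lagrangian: its integral depends on the boundary values only
and is unchanged under `u₁ ↦ c u₁`. Hence the two area integrals agree side by side and the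
difference vanishes (`integral_area_eq`). To pass from one side to the whole polygon, each identity
is written as the vanishing of a distribution (`localForm`), which can be checked locally by a
partition of unity. The vertices are removable: a point has zero `W^{1,2}` capacity in the plane
(`IsPiecewiseFlat.integral_eq_of_local`). The removal needs the coefficients of `∇χ`, of the type `u
∇u` or `u₁ u₂`, to be square integrable, so one factor is first truncated by a map that commutes
with rotations of `ℂ`, and thus preserves the boundary relation. The truncation is undone by an `L²`
limit. -/

lemma inner_eq_coord (x y : Plane) : inner ℝ x y = x 0 * y 0 + x 1 * y 1 := by
  simp [PiLp.inner_apply, Fin.sum_univ_two, mul_comm]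

lemma norm_sq_eq_coord (x : Plane) : ‖x‖ ^ 2 = x 0 ^ 2 + x 1 ^ 2 := by
  rw [EuclideanSpace.norm_sq_eq]; simp [Fin.sum_univ_two]

lemma convex_halfDisk (x ν : Plane) (r : ℝ) :
    Convex ℝ ({y : Plane | inner ℝ (y - x) ν < 0} ∩ Metric.ball x r) := by
  refine Convex.inter ?_ (convex_ball x r)
  have : {y : Plane | inner ℝ (y - x) ν < 0} = {y : Plane | innerSL ℝ ν y < inner ℝ x ν} := by
    ext y
    simp [inner_sub_left, real_inner_comm]
  rw [this]
  exact convex_halfSpace_lt (innerSL ℝ ν).isLinear _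

/-- A half-disk that does not meet the boundary lies inside `Ω` or outside its closure. -/
lemma halfDisk_subset_or_disjoint {Ω : Set Plane} (hΩ : IsOpen Ω) {x ν : Plane} {r : ℝ}
    (hr : frontier Ω ∩ Metric.ball x r ⊆ {y | inner ℝ (y - x) ν = 0}) :
    {y : Plane | inner ℝ (y - x) ν < 0} ∩ Metric.ball x r ⊆ Ω ∨
      Disjoint ({y : Plane | inner ℝ (y - x) ν < 0} ∩ Metric.ball x r) Ω := by
  by_contra! h
  obtain ⟨h1, h2⟩ := h
  rw [Set.not_subset] at h1
  rw [Set.not_disjoint_iff] at h2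
  obtain ⟨a, ha, ha'⟩ := h1
  obtain ⟨b, hb, hb'⟩ := h2
  have hfr : ∀ c ∈ {y : Plane | inner ℝ (y - x) ν < 0} ∩ Metric.ball x r, c ∉ frontier Ω := by
    intro c hc hc'
    have := hr ⟨hc', hc.2⟩
    have h3 := hc.1
    simp only [Set.mem_ofPred_eq] at this h3
    linarith
  -- Without boundary points, the half-disk is covered by the disjoint open sets `Ω` and the
  -- complement of its closure. Connectedness forbids it to meet both.
  obtain ⟨c, -, hc1, hc2⟩ := (convex_halfDisk x ν r).isPreconnected Ω (closure Ω)ᶜ hΩ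
    isClosed_closure.isOpen_compl (fun c hc => by
      by_cases h : c ∈ closure Ω
      · left
        have := hfr c hc
        rw [hΩ.frontier_eq] at this
        by_contra h'
        exact this ⟨h, h'⟩
      · exact Or.inr h) ⟨b, hb, hb'⟩ ⟨a, ha, fun h => hfr a ha (by
        rw [hΩ.frontier_eq]; exact ⟨h, ha'⟩)⟩
  exact hc2 (subset_closure hc1)

/-- The points of the closed half-disk inside the ball are limits of points of the half-disk. -/
lemma mem_closure_halfDisk {x ν y : Plane} {r : ℝ} (hν : ‖ν‖ = 1) (hy : y ∈ Metric.ball x r)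
    (hyν : inner ℝ (y - x) ν ≤ 0) :
    y ∈ closure ({y : Plane | inner ℝ (y - x) ν < 0} ∩ Metric.ball x r) := by
  have ht : Tendsto (fun t : ℝ => y - t • ν) (𝓝[>] 0) (𝓝 y) := by
    have : Continuous (fun t : ℝ => y - t • ν) := by fun_prop
    simpa using (this.tendsto 0).mono_left nhdsWithin_le_nhds
  refine mem_closure_of_tendsto ht ?_
  filter_upwards [self_mem_nhdsWithin, ht (Metric.isOpen_ball.mem_nhds hy)] with t ht0 ht1
  refine ⟨?_, ht1⟩
  have h0 : (0 : ℝ) < t := ht0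
  simp only [Set.mem_ofPred_eq, inner_sub_left, inner_smul_left, real_inner_self_eq_norm_sq, hν] at *
  simp
  linarith

/-- The line through `x` cuts the ball into two half-disks, each either inside `Ω` or disjoint from
it. Exactly one of them is inside, and `ν` or `-ν` points to the other one. -/
lemma exists_outwardUnitNormal_of_flat {Ω : Set Plane} (hΩ : IsOpen Ω)
    (hreg : interior (closure Ω) = Ω) {x ν : Plane} (hx : x ∈ frontier Ω) (hν : ‖ν‖ = 1) {r : ℝ}
    (hr0 : 0 < r)
    (hr : frontier Ω ∩ Metric.ball x r = {y | inner ℝ (y - x) ν = 0} ∩ Metric.ball x r) :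
    ∃ ν', IsOutwardUnitNormal Ω x ν' := by
  have hΩf : ∀ y ∈ Ω, y ∉ frontier Ω := fun y hy hy' => by
    rw [hΩ.frontier_eq] at hy'; exact hy'.2 hy
  have hsub : frontier Ω ∩ Metric.ball x r ⊆ {y | inner ℝ (y - x) ν = 0} := by
    rw [hr]; exact Set.inter_subset_left
  have hsub' : frontier Ω ∩ Metric.ball x r ⊆ {y | inner ℝ (y - x) (-ν) = 0} := by
    intro y hy
    have := hsub hy
    simpa [inner_neg_right] using this
  have key : ∀ μ : Plane, ‖μ‖ = 1 → (frontier Ω ∩ Metric.ball x r =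
      {y | inner ℝ (y - x) μ = 0} ∩ Metric.ball x r) →
      {y : Plane | inner ℝ (y - x) μ < 0} ∩ Metric.ball x r ⊆ Ω →
      Disjoint ({y : Plane | inner ℝ (y - x) (-μ) < 0} ∩ Metric.ball x r) Ω →
      IsOutwardUnitNormal Ω x μ := by
    intro μ hμ hrμ h1 h2
    refine ⟨hμ, r, hr0, Set.Subset.antisymm ?_ fun y hy => ⟨h1 hy, hy.2⟩⟩
    rintro y ⟨hyΩ, hyb⟩
    refine ⟨?_, hyb⟩
    rcases lt_trichotomy (inner ℝ (y - x) μ) 0 with h | h | h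
    · exact h
    · exact absurd ((hrμ.symm.subset ⟨h, hyb⟩).1) (hΩf y hyΩ)
    · refine absurd hyΩ (Set.disjoint_left.1 h2 ⟨?_, hyb⟩)
      simpa [inner_neg_right] using h
  rcases halfDisk_subset_or_disjoint hΩ hsub with h1 | h1 <;>
    rcases halfDisk_subset_or_disjoint hΩ hsub' with h2 | h2
  -- With `Ω` on both sides the boundary would be a slit, and `x` would be interior to the closure.
  -- This is where regularity of the open set enters.
  · exfalso
    have hball : Metric.ball x r ⊆ closure Ω := by
      intro y hy
      rcases le_total (inner ℝ (y - x) ν) 0 with h | h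
      · exact closure_mono h1 (mem_closure_halfDisk hν hy h)
      · exact closure_mono h2 (mem_closure_halfDisk (by simpa using hν) hy
          (by simpa [inner_neg_right] using h))
    have : x ∈ interior (closure Ω) :=
      interior_mono hball (by simpa [Metric.isOpen_ball.interior_eq] using hr0)
    rw [hreg] at this
    exact hΩf x this hx
  · exact ⟨ν, key ν hν hr h1 h2⟩
  · refine ⟨-ν, key (-ν) (by simpa using hν) ?_ h2 (by simpa using h1)⟩
    rw [hr]; ext y; simp [inner_neg_right]
  · exfalso
    have hxc : x ∈ closure Ω := frontier_subset_closure hx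
    obtain ⟨y, hyb, hyΩ⟩ := mem_closure_iff.1 hxc _ Metric.isOpen_ball (Metric.mem_ball_self hr0)
    rcases lt_trichotomy (inner ℝ (y - x) ν) 0 with h | h | h
    · exact Set.disjoint_left.1 h1 ⟨h, hyb⟩ hyΩ
    · exact hΩf y hyΩ (hr.symm.subset ⟨h, hyb⟩).1
    · exact Set.disjoint_left.1 h2 ⟨by simpa [inner_neg_right] using h, hyb⟩ hyΩ

lemma frontier_inter_ball {Ω : Set Plane} (hΩ : IsOpen Ω) {x ν : Plane} {r : ℝ} (hν : ‖ν‖ = 1)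
    (h : Ω ∩ Metric.ball x r = {y | inner ℝ (y - x) ν < 0} ∩ Metric.ball x r) :
    frontier Ω ∩ Metric.ball x r = {y | inner ℝ (y - x) ν = 0} ∩ Metric.ball x r := by
  ext y
  constructor
  · rintro ⟨hyf, hyb⟩
    rw [hΩ.frontier_eq] at hyf
    refine ⟨le_antisymm ?_ ?_, hyb⟩
    · have hcl : closure Ω ∩ Metric.ball x r ⊆ closure (Ω ∩ Metric.ball x r) := by
        rw [Set.inter_comm, Set.inter_comm Ω]; exact Metric.isOpen_ball.inter_closure
      have h1 := hcl ⟨hyf.1, hyb⟩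
      rw [h] at h1
      have hc : IsClosed {y : Plane | inner ℝ (y - x) ν ≤ 0} :=
        isClosed_le (by fun_prop) (by fun_prop)
      exact closure_minimal (fun z hz =>
        show inner ℝ (z - x) ν ≤ 0 from le_of_lt (show inner ℝ (z - x) ν < 0 from hz.1)) hc h1
    · by_contra! hlt
      exact hyf.2 (h.symm.subset ⟨hlt, hyb⟩).1
  · rintro ⟨hy, hyb⟩
    refine ⟨?_, hyb⟩
    rw [hΩ.frontier_eq]
    refine ⟨?_, fun hyΩ => ?_⟩
    · have := mem_closure_halfDisk hν hyb (le_of_eq hy)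
      rw [← h] at this
      exact closure_mono Set.inter_subset_left this
    · have := (h.subset ⟨hyΩ, hyb⟩).1
      simp only [Set.mem_ofPred_eq] at this hy
      linarith

/-- The outward unit normal is locally constant along the boundary. -/
lemma IsOutwardUnitNormal.of_mem_ball {Ω : Set Plane} (hΩ : IsOpen Ω) {x ν y : Plane} {r : ℝ}
    (hν : ‖ν‖ = 1) (h : Ω ∩ Metric.ball x r = {y | inner ℝ (y - x) ν < 0} ∩ Metric.ball x r)
    (hy : y ∈ frontier Ω) (hyb : y ∈ Metric.ball x r) : IsOutwardUnitNormal Ω y ν := by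
  have hy0 := ((frontier_inter_ball hΩ hν h).subset ⟨hy, hyb⟩).1
  simp only [Set.mem_ofPred_eq] at hy0
  obtain ⟨s, hs, hsub⟩ := Metric.isOpen_iff.1 Metric.isOpen_ball y hyb
  refine ⟨hν, s, hs, ?_⟩
  have e : ∀ z : Plane, inner ℝ (z - x) ν = inner ℝ (z - y) ν := fun z => by
    rw [← sub_add_sub_cancel z y x, inner_add_left, hy0, add_zero]
  ext z
  constructor
  · rintro ⟨h1, h2⟩
    have := (h.subset ⟨h1, hsub h2⟩).1
    exact ⟨by simpa [e] using this, h2⟩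
  · rintro ⟨h1, h2⟩
    refine ⟨(h.symm.subset ⟨?_, hsub h2⟩).1, h2⟩
    simpa [e] using h1

lemma exists_eq_add_smul_of_inner_eq_zero {d z : Plane} (hd : d ≠ 0)
    (h : inner ℝ z (!₂[-d 1, d 0] : Plane) = 0) : ∃ s : ℝ, z = s • d := by
  have hn : d 0 ^ 2 + d 1 ^ 2 ≠ 0 := by
    rw [← norm_sq_eq_coord]; simpa using hd
  refine ⟨(z 0 * d 0 + z 1 * d 1) / (d 0 ^ 2 + d 1 ^ 2), ?_⟩
  rw [inner_eq_coord] at h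
  simp at h
  ext i
  fin_cases i <;> simp <;> field_simp
  · linear_combination -d 1 * h
  · linear_combination d 0 * h

/-- A point in the relative interior of a segment has a neighbourhood in which the segment is
a straight line. -/
lemma segment_inter_ball {a b x : Plane} (hab : a ≠ b) (hx : x ∈ segment ℝ a b) (hxa : x ≠ a)
    (hxb : x ≠ b) : ∃ ν : Plane, ‖ν‖ = 1 ∧ ∃ r > 0, ∀ s ≤ r,
      segment ℝ a b ∩ Metric.ball x s = {y | inner ℝ (y - x) ν = 0} ∩ Metric.ball x s := by
  rw [segment_eq_image'] at hx
  obtain ⟨t, ⟨ht0, ht1⟩, rfl⟩ := hx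
  have hd : b - a ≠ 0 := sub_ne_zero.2 hab.symm
  set d := b - a with hdd
  have ht0' : 0 < t := lt_of_le_of_ne ht0 fun h => hxa (by simp [← h])
  have ht1' : t < 1 := lt_of_le_of_ne ht1 fun h => hxb (by simp [h, hdd])
  have hdn : 0 < ‖d‖ := norm_pos_iff.2 hd
  set w : Plane := !₂[-d 1, d 0] with hw
  have hwn : ‖w‖ = ‖d‖ := by
    rw [← sq_eq_sq₀ (norm_nonneg _) (norm_nonneg _), norm_sq_eq_coord, norm_sq_eq_coord]
    simp [hw]; ring
  have hdw : inner ℝ d w = 0 := by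
    rw [inner_eq_coord]; simp [hw]; ring
  -- The radius is the distance from `x` to the nearer endpoint. All smaller radii are allowed as
  -- well, so that the ball can later be shrunk away from the other sides.
  refine ⟨‖d‖⁻¹ • w, by rw [norm_smul, hwn]; simp [hdn.ne'], min t (1 - t) * ‖d‖,
    mul_pos (lt_min ht0' (by linarith)) hdn, fun s hs => ?_⟩
  ext y
  constructor
  · rintro ⟨hy, hyb⟩
    refine ⟨?_, hyb⟩
    rw [segment_eq_image'] at hy
    obtain ⟨t', -, rfl⟩ := hy
    have : a + t' • (b - a) - (a + t • d) = (t' - t) • d := by rw [← hdd]; module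
    simp only [Set.mem_ofPred_eq]
    rw [this, inner_smul_left, inner_smul_right, hdw]
    simp
  · rintro ⟨hy, hyb⟩
    refine ⟨?_, hyb⟩
    simp only [Set.mem_ofPred_eq, inner_smul_right, mul_eq_zero, inv_eq_zero, hdn.ne',
      false_or] at hy
    obtain ⟨q, hq⟩ := exists_eq_add_smul_of_inner_eq_zero hd hy
    rw [mem_ball_iff_norm, hq, norm_smul, Real.norm_eq_abs] at hyb
    have hq2 : |q| < min t (1 - t) := by
      have := hyb.trans_le hs
      exact lt_of_mul_lt_mul_right this hdn.le
    rw [lt_min_iff, abs_lt, abs_lt] at hq2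
    rw [segment_eq_image']
    refine ⟨t + q, ⟨by linarith [hq2.1.1], by linarith [hq2.2.2]⟩, ?_⟩
    simp only [← hdd]
    rw [eq_comm, ← sub_add_cancel y (a + t • d), hq]
    module

lemma isCompact_segment (a b : Plane) : IsCompact (segment ℝ a b) := by
  rw [segment_eq_image']
  exact isCompact_Icc.image (by fun_prop)

/-! ### Polygons as piecewise flat domains. -/

/-- The data of a polygon on which the Gauss-Green formula rests: a bounded open set whose boundary
has finite length and which is locally a half-plane at all boundary points outside a finite set. -/
structure IsPiecewiseFlat (Ω : Set Plane) (V : Set Plane) : Prop where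
  isOpen : IsOpen Ω
  isBounded : Bornology.IsBounded Ω
  finite : V.Finite
  boundary_lt_top : boundaryMeasure Ω Set.univ < ⊤
  exists_normal : ∀ x ∈ frontier Ω, x ∉ V → ∃ ν, IsOutwardUnitNormal Ω x ν

lemma IsPolygon.exists_isPiecewiseFlat {Ω : Set Plane} (h : IsPolygon Ω) :
    ∃ V, IsPiecewiseFlat Ω V := by
  obtain ⟨hO, hB, hreg, n, v, hc, hfr⟩ := h
  have h3 := hc.three_le
  -- Three or more vertices make `ZMod n` finite and nontrivial. The latter gives `i ≠ i + 1`, so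
  -- the sides are nondegenerate.
  have : NeZero n := ⟨by omega⟩
  have : Fact (1 < n) := ⟨by omega⟩
  refine ⟨Set.range v, hO, hB, Set.finite_range v, ?_, ?_⟩
  · rw [boundaryMeasure, Measure.restrict_apply_univ, hfr]
    refine (measure_iUnion_le _).trans_lt ?_
    rw [tsum_fintype]
    refine ENNReal.sum_lt_top.2 fun i _ => ?_
    rw [side, hausdorffMeasure_segment]
    exact edist_lt_top _ _
  · intro x hx hxv
    have hxv' : ∀ i, x ≠ v i := fun i h => hxv ⟨i, h.symm⟩
    have hx' := hx
    rw [hfr, Set.mem_iUnion] at hx'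
    obtain ⟨i, hi⟩ := hx'
    have hne : v i ≠ v (i + 1) := fun h => by
      have := hc.injective h
      simp at this
    obtain ⟨ν, hν, r, hr, hseg⟩ := segment_inter_ball hne hi (hxv' i) (hxv' (i + 1))
    have hother : ∀ j, j ≠ i → x ∉ side v j := by
      intro j hj hxj
      by_cases h1 : j = i + 1
      · subst h1
        exact hxv' (i + 1) ((hc.consecutive i).subset ⟨hi, hxj⟩)
      by_cases h2 : i = j + 1
      · subst h2
        exact hxv' (j + 1) ((hc.consecutive j).subset ⟨hxj, hi⟩)
      exact Set.disjoint_left.1 (hc.disjoint i j hj h1 h2) hi hxj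
    have hcl : IsClosed (⋃ j ∈ {j | j ≠ i}, side v j) :=
      (Set.toFinite _).isClosed_biUnion fun j _ => (isCompact_segment _ _).isClosed
    have hxU : x ∈ (⋃ j ∈ {j | j ≠ i}, side v j)ᶜ := by
      simp only [Set.mem_compl_iff, Set.mem_iUnion, not_exists]
      exact fun j hj => hother j hj
    -- The other sides form a closed set missing `x`, so in a small ball the boundary is the side
    -- `i` alone.
    obtain ⟨s, hs, hsub⟩ := Metric.isOpen_iff.1 hcl.isOpen_compl x hxU
    refine exists_outwardUnitNormal_of_flat hO hreg hx hν (lt_min hr hs) ?_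
    rw [← hseg _ (min_le_left _ _), hfr]
    ext y
    constructor
    · rintro ⟨hy, hyb⟩
      refine ⟨?_, hyb⟩
      obtain ⟨j, hj⟩ := Set.mem_iUnion.1 hy
      by_cases hji : j = i
      · exact hji ▸ hj
      · exact absurd (Set.mem_biUnion (show j ∈ {j | j ≠ i} from hji) hj)
          (hsub (Metric.ball_subset_ball (min_le_right _ _) hyb))
    · rintro ⟨hy, hyb⟩
      exact ⟨Set.mem_iUnion.2 ⟨i, hy⟩, hyb⟩

/-! ### The Gauss-Green formula near the sides -/

/-- The vector `ν` rotated by a right angle. -/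
def rotate (ν : Plane) : Plane := !₂[-ν 1, ν 0]

lemma norm_rotate (ν : Plane) : ‖rotate ν‖ = ‖ν‖ := by
  rw [← sq_eq_sq₀ (norm_nonneg _) (norm_nonneg _), norm_sq_eq_coord, norm_sq_eq_coord]
  simp [rotate]; ring

lemma inner_rotate_left (ν : Plane) : inner ℝ (rotate ν) ν = 0 := by
  rw [inner_eq_coord]; simp [rotate]; ring

/-- Orthonormal coordinates with origin `x` and axes along `ν` and `rotate ν`. -/
def frame (x ν : Plane) (p : ℝ × ℝ) : Plane := x + (p.1 • ν + p.2 • rotate ν)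

lemma inner_frame (x : Plane) {ν : Plane} (hν : ‖ν‖ = 1) (p : ℝ × ℝ) :
    inner ℝ (frame x ν p - x) ν = p.1 := by
  simp [frame, inner_add_left, inner_smul_left, inner_rotate_left, hν]

lemma inner_frame_rotate (x : Plane) {ν : Plane} (hν : ‖ν‖ = 1) (p : ℝ × ℝ) :
    inner ℝ (frame x ν p - x) (rotate ν) = p.2 := by
  have h : inner ℝ ν (rotate ν) = 0 := by rw [real_inner_comm]; exact inner_rotate_left ν
  simp [frame, inner_add_left, inner_smul_left, h, norm_rotate, hν]

lemma continuous_frame (x ν : Plane) : Continuous (frame x ν) := by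
  unfold frame; fun_prop

lemma frame_injective (x : Plane) {ν : Plane} (hν : ‖ν‖ = 1) : Function.Injective (frame x ν) := by
  intro p q h
  ext
  · rw [← inner_frame x hν p, ← inner_frame x hν q, h]
  · rw [← inner_frame_rotate x hν p, ← inner_frame_rotate x hν q, h]

lemma measurableEmbedding_frame (x : Plane) {ν : Plane} (hν : ‖ν‖ = 1) :
    MeasurableEmbedding (frame x ν) :=
  (continuous_frame x ν).measurableEmbedding (frame_injective x hν)

lemma orthonormal_rotate {ν : Plane} (hν : ‖ν‖ = 1) : Orthonormal ℝ ![ν, rotate ν] := by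
  have h : inner ℝ ν (rotate ν) = 0 := by rw [real_inner_comm]; exact inner_rotate_left ν
  constructor
  · intro i; fin_cases i <;> simp [norm_rotate, hν]
  · intro i j hij
    fin_cases i <;> fin_cases j <;> simp_all [inner_rotate_left]

lemma measurePreserving_frame (x : Plane) {ν : Plane} (hν : ‖ν‖ = 1) :
    MeasurePreserving (frame x ν) := by
  have hb := orthonormal_rotate hν
  have hsp : ⊤ ≤ Submodule.span ℝ (Set.range ![ν, rotate ν]) := by
    rw [hb.linearIndependent.span_eq_top_of_card_eq_finrank (by simp)]
  let b := OrthonormalBasis.mk hb hsp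
  have h := (measurePreserving_add_left (volume : Measure Plane) x).comp
    (b.measurePreserving_repr_symm.comp ((PiLp.volume_preserving_toLp (Fin 2)).comp
      ((volume_preserving_finTwoArrow ℝ).symm _)))
  have e : frame x ν = (fun y => x + y) ∘ b.repr.symm ∘ WithLp.toLp 2 ∘
      MeasurableEquiv.finTwoArrow.symm := by
    funext p
    simp only [Function.comp, frame]
    congr 1
    rw [← b.sum_repr_symm]
    simp [b, Fin.sum_univ_two]
  rw [e]
  exact h

lemma isometry_frame_snd (x : Plane) {ν : Plane} (hν : ‖ν‖ = 1) :
    Isometry fun t : ℝ => frame x ν (0, t) := by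
  refine Isometry.of_dist_eq fun s t => ?_
  rw [dist_eq_norm, dist_eq_norm]
  have : frame x ν (0, s) - frame x ν (0, t) = (s - t) • rotate ν := by
    simp only [frame]; module
  rw [this, norm_smul, norm_rotate, hν, mul_one]

lemma range_frame_snd (x : Plane) {ν : Plane} (hν : ‖ν‖ = 1) :
    Set.range (fun t : ℝ => frame x ν (0, t)) = {y | inner ℝ (y - x) ν = 0} := by
  ext y
  constructor
  · rintro ⟨t, rfl⟩
    exact inner_frame x hν _
  · intro h
    have h0 : ν ≠ 0 := fun h => by simp [h] at hν
    have hd : rotate ν ≠ 0 := fun h => h0 (by rw [← norm_eq_zero, ← norm_rotate, h, norm_zero])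
    obtain ⟨s, hs⟩ := exists_eq_add_smul_of_inner_eq_zero (z := y - x) hd (by
      rw [Set.mem_ofPred_eq, inner_eq_coord] at h
      rw [inner_eq_coord]
      simp [rotate] at h ⊢
      linarith)
    refine ⟨s, ?_⟩
    simp only [frame, ← hs]
    module

/-- Integration over a line with respect to arc length. -/
lemma setIntegral_line (x : Plane) {ν : Plane} (hν : ‖ν‖ = 1) (f : Plane → ℂ) :
    ∫ y in {y | inner ℝ (y - x) ν = 0}, f y ∂(Measure.hausdorffMeasure 1) =
      ∫ t : ℝ, f (frame x ν (0, t)) := by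
  have h := (isometry_frame_snd x hν).map_hausdorffMeasure (d := 1) (Or.inl zero_le_one)
  rw [hausdorffMeasure_real, range_frame_snd x hν] at h
  rw [← h]
  have hc : Continuous fun t : ℝ => frame x ν (0, t) := (isometry_frame_snd x hν).continuous
  exact (hc.measurableEmbedding (isometry_frame_snd x hν).injective).integral_map _

variable {f : Plane → ℂ}

lemma hasDerivAt_frame_fst (hf : ContDiff ℝ ∞ f) (x ν : Plane) (s t : ℝ) :
    HasDerivAt (fun s => f (frame x ν (s, t))) (fderiv ℝ f (frame x ν (s, t)) ν) s := by
  have h1 : HasDerivAt (fun s => frame x ν (s, t)) ν s := by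
    have := ((hasDerivAt_id s).smul_const ν).add_const (t • rotate ν) |>.const_add x
    simpa [frame] using this
  exact ((hf.differentiable (by simp)) _).hasFDerivAt.comp_hasDerivAt s h1

lemma hasDerivAt_frame_snd (hf : ContDiff ℝ ∞ f) (x ν : Plane) (s t : ℝ) :
    HasDerivAt (fun t => f (frame x ν (s, t))) (fderiv ℝ f (frame x ν (s, t)) (rotate ν)) t := by
  have h1 : HasDerivAt (fun t => frame x ν (s, t)) (rotate ν) t := by
    have := ((hasDerivAt_id t).smul_const (rotate ν)).const_add (s • ν) |>.const_add x
    simpa [frame] using this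
  exact ((hf.differentiable (by simp)) _).hasFDerivAt.comp_hasDerivAt t h1

/-- `ℝ × ℝ` carries the sup norm, so `frame` is not an isometry. It is bi-Lipschitz, with constants
`1` and `2`, and that makes it a closed embedding. -/
lemma hasCompactSupport_comp_frame (hc : HasCompactSupport f) (x : Plane) {ν : Plane}
    (hν : ‖ν‖ = 1) : HasCompactSupport fun p => f (frame x ν p) := by
  refine hc.comp_isClosedEmbedding ?_
  have : AntilipschitzWith 1 (frame x ν) := by
    refine AntilipschitzWith.of_le_mul_dist fun p q => ?_
    have e : frame x ν p - frame x ν q = frame 0 ν (p - q) := by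
      simp only [frame, Prod.fst_sub, Prod.snd_sub]; module
    have h1 := abs_real_inner_le_norm (frame 0 ν (p - q)) ν
    have h2 := abs_real_inner_le_norm (frame 0 ν (p - q)) (rotate ν)
    have i1 := inner_frame 0 hν (p - q)
    have i2 := inner_frame_rotate 0 hν (p - q)
    rw [sub_zero] at i1 i2
    rw [i1, hν] at h1
    rw [i2, norm_rotate, hν] at h2
    rw [dist_eq_norm, dist_eq_norm, e]
    simp only [Prod.norm_def, Real.norm_eq_abs, NNReal.coe_one, one_mul]
    exact max_le (by simpa using h1) (by simpa using h2)
  refine this.isClosedEmbedding ?_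
  have hlip : LipschitzWith 2 (frame x ν) := by
    refine LipschitzWith.of_dist_le_mul fun p q => ?_
    have e : frame x ν p - frame x ν q = (p - q).1 • ν + (p - q).2 • rotate ν := by
      simp only [frame, Prod.fst_sub, Prod.snd_sub]; module
    rw [dist_eq_norm, dist_eq_norm, e]
    refine (norm_add_le _ _).trans ?_
    rw [norm_smul, norm_smul, norm_rotate, hν, mul_one, mul_one, NNReal.coe_ofNat, two_mul]
    exact add_le_add (norm_fst_le _) (norm_snd_le _)
  exact hlip.uniformContinuous

lemma integrable_fderiv_comp_frame (hf : ContDiff ℝ ∞ f) (hc : HasCompactSupport f) (x : Plane)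
    {ν : Plane} (hν : ‖ν‖ = 1) (w : Plane) :
    Integrable fun p => fderiv ℝ f (frame x ν p) w := by
  have h1 : Continuous fun y => fderiv ℝ f y w :=
    (hf.continuous_fderiv (by simp)).clm_apply continuous_const
  refine Continuous.integrable_of_hasCompactSupport (h1.comp (continuous_frame x ν)) ?_
  refine hasCompactSupport_comp_frame (f := fun y => fderiv ℝ f y w) ?_ x hν
  exact hc.fderiv_apply (𝕜 := ℝ) w

lemma setIntegral_halfPlane (x : Plane) {ν : Plane} (hν : ‖ν‖ = 1) (g : Plane → ℂ) :
    ∫ y in {y | inner ℝ (y - x) ν < 0}, g y =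
      ∫ p in Set.Iio (0 : ℝ) ×ˢ (Set.univ : Set ℝ), g (frame x ν p) := by
  rw [← (measurePreserving_frame x hν).setIntegral_preimage_emb (measurableEmbedding_frame x hν)]
  congr 2
  ext p
  simp [inner_frame x hν]

lemma slice_hasCompactSupport_fst {h : ℝ × ℝ → ℂ} (hh : HasCompactSupport h) (s : ℝ) :
    HasCompactSupport fun t => h (s, t) :=
  hh.comp_isClosedEmbedding (Isometry.isClosedEmbedding (Isometry.of_dist_eq fun a b => by simp))

lemma slice_hasCompactSupport_snd {h : ℝ × ℝ → ℂ} (hh : HasCompactSupport h) (t : ℝ) :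
    HasCompactSupport fun s => h (s, t) :=
  hh.comp_isClosedEmbedding (Isometry.isClosedEmbedding (Isometry.of_dist_eq fun a b => by simp))

lemma contDiff_frame (x ν : Plane) : ContDiff ℝ ∞ (frame x ν) := by
  unfold frame; fun_prop

/-- With the tangential variable innermost, each slice is the integral over a full line of the
derivative of a compactly supported function. -/
lemma setIntegral_halfPlane_fderiv_tangent (hf : ContDiff ℝ ∞ f) (hc : HasCompactSupport f)
    (x : Plane) {ν : Plane} (hν : ‖ν‖ = 1) :
    ∫ y in {y | inner ℝ (y - x) ν < 0}, fderiv ℝ f y (rotate ν) = 0 := by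
  rw [setIntegral_halfPlane x hν, Measure.volume_eq_prod, setIntegral_prod _
    (integrable_fderiv_comp_frame hf hc x hν _).integrableOn]
  refine setIntegral_eq_zero_of_forall_eq_zero fun s _ => ?_
  rw [Measure.restrict_univ]
  have hcs := slice_hasCompactSupport_fst (hasCompactSupport_comp_frame hc x hν) s
  have hd : (fun t => fderiv ℝ f (frame x ν (s, t)) (rotate ν)) =
      deriv fun t => f (frame x ν (s, t)) :=
    funext fun t => (hasDerivAt_frame_snd hf x ν s t).deriv.symm
  have hsm : ContDiff ℝ ∞ fun t => f (frame x ν (s, t)) :=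
    hf.comp ((contDiff_frame x ν).comp (by fun_prop))
  rw [hd]
  exact integral_eq_zero_of_hasDerivAt_of_integrable
    (fun t => (hsm.differentiable (by simp) t).hasDerivAt)
    ((hsm.continuous_deriv (by simp)).integrable_of_hasCompactSupport hcs.deriv)
    (hsm.continuous.integrable_of_hasCompactSupport hcs)

/-- Fubini in the other order: each normal slice is a half-line ending on the boundary, and the
fundamental theorem of calculus leaves the boundary value. -/
lemma setIntegral_halfPlane_fderiv_normal (hf : ContDiff ℝ ∞ f) (hc : HasCompactSupport f)
    (x : Plane) {ν : Plane} (hν : ‖ν‖ = 1) :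
    ∫ y in {y | inner ℝ (y - x) ν < 0}, fderiv ℝ f y ν = ∫ t : ℝ, f (frame x ν (0, t)) := by
  rw [setIntegral_halfPlane x hν, Measure.volume_eq_prod, ← setIntegral_prod_swap,
    setIntegral_prod (fun z : ℝ × ℝ => fderiv ℝ f (frame x ν z.swap) ν)
      ((integrable_fderiv_comp_frame hf hc x hν ν).swap).integrableOn, Measure.restrict_univ]
  refine integral_congr_ae (Eventually.of_forall fun t => ?_)
  have hcs := slice_hasCompactSupport_snd (hasCompactSupport_comp_frame hc x hν) t
  have hd : (fun s => fderiv ℝ f (frame x ν (s, t)) ν) =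
      deriv fun s => f (frame x ν (s, t)) :=
    funext fun s => (hasDerivAt_frame_fst hf x ν s t).deriv.symm
  have hsm : ContDiff ℝ ∞ fun s => f (frame x ν (s, t)) :=
    hf.comp ((contDiff_frame x ν).comp (by fun_prop))
  simp only [Prod.swap_prod_mk, hd]
  rw [← integral_Iic_eq_integral_Iio]
  exact hcs.integral_Iic_deriv_eq (hsm.of_le (by simp)) 0

lemma single_eq_frame {ν : Plane} (hν : ‖ν‖ = 1) (j : Fin 2) :
    EuclideanSpace.single j (1 : ℝ) = ν j • ν + rotate ν j • rotate ν := by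
  have h := norm_sq_eq_coord ν
  rw [hν] at h
  ext i
  fin_cases i <;> fin_cases j <;> simp [rotate] <;> linarith

/-- The Gauss-Green formula in a half-plane. -/
lemma setIntegral_halfPlane_partialDeriv (hf : ContDiff ℝ ∞ f) (hc : HasCompactSupport f)
    (x : Plane) {ν : Plane} (hν : ‖ν‖ = 1) (j : Fin 2) :
    ∫ y in {y | inner ℝ (y - x) ν < 0}, partialDeriv j f y =
      (ν j : ℂ) * ∫ y in {y | inner ℝ (y - x) ν = 0}, f y ∂(Measure.hausdorffMeasure 1) := by
  have hi : ∀ w, Integrable fun y => fderiv ℝ f y w := fun w =>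
    ((hf.continuous_fderiv (by simp)).clm_apply continuous_const).integrable_of_hasCompactSupport
      (hc.fderiv_apply (𝕜 := ℝ) w)
  have e : ∀ y, partialDeriv j f y =
      (ν j : ℂ) * fderiv ℝ f y ν + (rotate ν j : ℂ) * fderiv ℝ f y (rotate ν) := fun y => by
    rw [partialDeriv, single_eq_frame hν j]
    simp
  simp only [e]
  rw [integral_add ((hi _).const_mul _).integrableOn ((hi _).const_mul _).integrableOn,
    integral_const_mul, integral_const_mul, setIntegral_halfPlane_fderiv_tangent hf hc x hν,
    setIntegral_halfPlane_fderiv_normal hf hc x hν, setIntegral_line x hν, mul_zero, add_zero]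

/-! ### Flat patches: neighbourhoods with a constant normal. -/

/-- The Gauss-Green formula on `Ω` for smooth functions supported in `U`, with the constant
normal `ν`. -/
def GaussGreenOn (Ω U : Set Plane) (ν : Plane) : Prop :=
  ∀ f : Plane → ℂ, ContDiff ℝ ∞ f → HasCompactSupport f → tsupport f ⊆ U → ∀ j,
    ∫ x in Ω, partialDeriv j f x = (ν j : ℂ) * ∫ x, f x ∂(boundaryMeasure Ω)

/-- `U` meets the boundary at most in points with outward unit normal `ν`, and the Gauss-Green
formula holds in `U`. -/
structure IsFlatPatch (Ω U : Set Plane) (ν : Plane) : Prop where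
  isOpen : IsOpen U
  gaussGreen : GaussGreenOn Ω U ν
  normal : ∀ y ∈ frontier Ω, y ∈ U → IsOutwardUnitNormal Ω y ν

lemma partialDeriv_eq_zero_of_notMem {E : Type*} [NormedAddCommGroup E] [NormedSpace ℝ E]
    {f : Plane → E} {x : Plane} (j : Fin 2) (h : x ∉ tsupport f) : partialDeriv j f x = 0 := by
  rw [partialDeriv, fderiv_of_notMem_tsupport ℝ h]; rfl

lemma setIntegral_partialDeriv_eq_zero (hf : ContDiff ℝ ∞ f) (hc : HasCompactSupport f)
    {Ω : Set Plane} (hsub : tsupport f ⊆ Ω) (j : Fin 2) : ∫ x in Ω, partialDeriv j f x = 0 := by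
  rw [setIntegral_eq_integral_of_forall_compl_eq_zero fun x hx =>
    partialDeriv_eq_zero_of_notMem j fun h => hx (hsub h)]
  have hi : Integrable fun y => fderiv ℝ f y (EuclideanSpace.single j 1) :=
    ((hf.continuous_fderiv (by simp)).clm_apply continuous_const).integrable_of_hasCompactSupport
      (hc.fderiv_apply (𝕜 := ℝ) _)
  have h := integral_mul_fderiv_eq_neg_fderiv_mul_of_integrable (𝕜 := ℂ) (μ := volume)
    (f := fun _ : Plane => (1 : ℂ)) (g := f) (v := EuclideanSpace.single j (1 : ℝ))
    (by simp) (by simpa using hi)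
    (by simpa using hf.continuous.integrable_of_hasCompactSupport hc)
    (fun _ _ => by fun_prop) (fun x _ => hf.differentiable (by simp) x)
  simpa [partialDeriv] using h

/-- Away from the boundary no normal exists. The placeholder `0` makes the right side of Gauss-Green
vanish, as the left side does, and the condition on normals is vacuous. -/
lemma isFlatPatch_of_disjoint {Ω U : Set Plane} (hU : IsOpen U) (h : U ⊆ Ω ∨ Disjoint U Ω)
    (hf : Disjoint U (frontier Ω)) : IsFlatPatch Ω U 0 := by
  refine ⟨hU, fun f hf1 hf2 hsub j => ?_, fun y hy hyU => absurd hy (Set.disjoint_left.1 hf hyU)⟩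
  simp only [PiLp.zero_apply, Complex.ofReal_zero, zero_mul]
  rcases h with h | h
  · exact setIntegral_partialDeriv_eq_zero hf1 hf2 (hsub.trans h) j
  · exact setIntegral_eq_zero_of_forall_eq_zero fun x hx =>
      partialDeriv_eq_zero_of_notMem j fun h' => Set.disjoint_left.1 h (hsub h') hx

lemma setIntegral_congr_of_inter {μ : Measure Plane} {S T U : Set Plane} (hS : MeasurableSet S)
    (hT : MeasurableSet T) {g : Plane → ℂ} (hg : ∀ x ∉ U, g x = 0) (h : S ∩ U = T ∩ U) :
    ∫ x in S, g x ∂μ = ∫ x in T, g x ∂μ := by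
  rw [← integral_indicator hS, ← integral_indicator hT]
  congr 1
  ext x
  by_cases hx : x ∈ U
  · have : x ∈ S ↔ x ∈ T := by
      have := Set.ext_iff.1 h x
      simpa [hx] using this
    by_cases hxS : x ∈ S
    · rw [Set.indicator_of_mem hxS, Set.indicator_of_mem (this.1 hxS)]
    · rw [Set.indicator_of_notMem hxS, Set.indicator_of_notMem fun h => hxS (this.2 h)]
  · simp [Set.indicator, hg x hx]

lemma IsOutwardUnitNormal.exists_isFlatPatch {Ω : Set Plane} (hΩ : IsOpen Ω) {x ν : Plane}
    (h : IsOutwardUnitNormal Ω x ν) : ∃ U, x ∈ U ∧ IsFlatPatch Ω U ν := by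
  obtain ⟨hν, r, hr, hb⟩ := h
  refine ⟨Metric.ball x r, Metric.mem_ball_self hr, Metric.isOpen_ball, fun f hf hc hsub j => ?_,
    fun y hy hyb => .of_mem_ball hΩ hν hb hy hyb⟩
  have m1 : MeasurableSet {y : Plane | inner ℝ (y - x) ν < 0} :=
    (isOpen_lt (by fun_prop) (by fun_prop)).measurableSet
  have m2 : MeasurableSet {y : Plane | inner ℝ (y - x) ν = 0} :=
    (isClosed_eq (by fun_prop) (by fun_prop)).measurableSet
  -- As `f` is supported in the ball, `Ω` may be replaced by the half-plane and its boundary by the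
  -- full line.
  rw [setIntegral_congr_of_inter hΩ.measurableSet m1
    (fun y hy => partialDeriv_eq_zero_of_notMem j fun h => hy (hsub h)) hb, boundaryMeasure,
    setIntegral_congr_of_inter isClosed_frontier.measurableSet m2
    (fun y hy => image_eq_zero_of_notMem_tsupport fun h => hy (hsub h))
    (frontier_inter_ball hΩ hν hb)]
  exact setIntegral_halfPlane_partialDeriv hf hc x hν j

lemma IsPiecewiseFlat.exists_isFlatPatch {Ω V : Set Plane} (h : IsPiecewiseFlat Ω V) {x : Plane}
    (hx : x ∉ V) : ∃ U ν, x ∈ U ∧ IsFlatPatch Ω U ν := by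
  by_cases hxf : x ∈ frontier Ω
  · obtain ⟨ν, hν⟩ := h.exists_normal x hxf hx
    obtain ⟨U, hU⟩ := hν.exists_isFlatPatch h.isOpen
    exact ⟨U, ν, hU⟩
  by_cases hxΩ : x ∈ Ω
  · refine ⟨Ω, 0, hxΩ, isFlatPatch_of_disjoint h.isOpen (Or.inl subset_rfl) ?_⟩
    rw [h.isOpen.frontier_eq]
    exact Set.disjoint_sdiff_right
  · refine ⟨(closure Ω)ᶜ, 0, fun hc => hxf ?_,
      isFlatPatch_of_disjoint isClosed_closure.isOpen_compl (Or.inr ?_) ?_⟩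
    · rw [h.isOpen.frontier_eq]; exact ⟨hc, hxΩ⟩
    · exact Set.disjoint_left.2 fun y hy hy' => hy (subset_closure hy')
    · exact Set.disjoint_left.2 fun y hy hy' => hy (frontier_subset_closure hy')

/-! ### Convergence in `L²` -/

section L2

variable {α : Type*} [MeasurableSpace α] {μ : Measure α}

/-- Dominated convergence for the squared norm of `F n - f`, with majorant `(2G)²`. -/
lemma tendsto_eLpNorm_two_of_dominated {E : Type*} [NormedAddCommGroup E] {F : ℕ → α → E}
    {f : α → E} {G : α → ℝ} (hF : ∀ n, AEStronglyMeasurable (F n) μ)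
    (hf : AEStronglyMeasurable f μ) (hG : MemLp G 2 μ) (hle : ∀ n, ∀ᵐ x ∂μ, ‖F n x‖ ≤ G x)
    (hlim : ∀ᵐ x ∂μ, Tendsto (fun n => F n x) atTop (𝓝 (f x))) :
    Tendsto (fun n => eLpNorm (fun x => F n x - f x) 2 μ) atTop (𝓝 0) := by
  have hfG : ∀ᵐ x ∂μ, ‖f x‖ ≤ G x := by
    filter_upwards [hlim, ae_all_iff.2 hle] with x h1 h2
    exact le_of_tendsto h1.norm (Eventually.of_forall h2)
  have key : Tendsto (fun n => ∫⁻ x, ‖F n x - f x‖ₑ ^ (2 : ℝ) ∂μ) atTop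
      (𝓝 (∫⁻ _, 0 ∂μ)) := by
    refine tendsto_lintegral_of_dominated_convergence' (fun x => ‖(2 : ℝ) * G x‖ₑ ^ (2 : ℝ))
      (fun n => ((hF n).sub hf).enorm.pow_const _) (fun n => ?_) ?_ ?_
    · filter_upwards [hle n, hfG] with x h1 h2
      gcongr
      rw [enorm_le_iff_norm_le, Real.norm_eq_abs]
      refine (norm_sub_le _ _).trans (le_trans ?_ (le_abs_self _))
      linarith
    · have := (hG.const_mul 2).2
      rw [eLpNorm_lt_top_iff_lintegral_rpow_enorm_lt_top (by simp) (by simp)] at this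
      simpa using this.ne
    · filter_upwards [hlim] with x hx
      have h0 : Tendsto (fun n => F n x - f x) atTop (𝓝 0) := by
        simpa using hx.sub_const (f x)
      have h1 := h0.enorm
      have h2 := (ENNReal.continuous_rpow_const (y := 2)).tendsto _ |>.comp h1
      simpa [Function.comp_def] using h2
  rw [lintegral_zero] at key
  have h2 := (ENNReal.continuous_rpow_const (y := 1 / 2)).tendsto _ |>.comp key
  rw [ENNReal.zero_rpow_of_pos (by norm_num)] at h2
  refine h2.congr fun n => ?_
  rw [eLpNorm_eq_lintegral_rpow_enorm_toReal (by simp) (by simp)]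
  simp

lemma norm_integral_mul_le {f g : α → ℂ} (hf : MemLp f 2 μ) (hg : MemLp g 2 μ) :
    ‖∫ x, f x * g x ∂μ‖ₑ ≤ eLpNorm f 2 μ * eLpNorm g 2 μ := by
  refine (enorm_integral_le_lintegral_enorm _).trans ?_
  have h := eLpNorm_smul_le_mul_eLpNorm (p := 2) (q := 2) (r := 1) hg.1 hf.1
  rwa [eLpNorm_one_eq_lintegral_enorm] at h

lemma integrable_mul_two {f g : α → ℂ} (hf : MemLp f 2 μ) (hg : MemLp g 2 μ) :
    Integrable (fun x => f x * g x) μ :=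
  MemLp.integrable_mul hf hg

lemma tendsto_integral_mul_of_eLpNorm {F : ℕ → α → ℂ} {f h : α → ℂ} (hF : ∀ n, MemLp (F n) 2 μ)
    (hf : MemLp f 2 μ) (hh : MemLp h 2 μ)
    (hlim : Tendsto (fun n => eLpNorm (fun x => F n x - f x) 2 μ) atTop (𝓝 0)) :
    Tendsto (fun n => ∫ x, F n x * h x ∂μ) atTop (𝓝 (∫ x, f x * h x ∂μ)) := by
  rw [tendsto_iff_edist_tendsto_0]
  have h0 : Tendsto (fun n => eLpNorm (fun x => F n x - f x) 2 μ * eLpNorm h 2 μ) atTop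
      (𝓝 (0 * eLpNorm h 2 μ)) :=
    ENNReal.Tendsto.mul_const hlim (Or.inr hh.2.ne)
  rw [zero_mul] at h0
  refine tendsto_of_tendsto_of_tendsto_of_le_of_le tendsto_const_nhds h0
    (fun _ => zero_le) fun n => ?_
  simp only [edist_eq_enorm_sub]
  rw [← integral_sub (integrable_mul_two (hF n) hh) (integrable_mul_two hf hh)]
  simp only [← sub_mul]
  exact norm_integral_mul_le ((hF n).sub hf) hh

end L2

/-! ### Localization -/

section Localization

lemma continuous_partialDeriv {f : Plane → ℂ} (hf : ContDiff ℝ ∞ f) (j : Fin 2) :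
    Continuous (partialDeriv j f) :=
  (hf.continuous_fderiv (by simp)).clm_apply continuous_const

lemma contDiff_partialDeriv {f : Plane → ℂ} (hf : ContDiff ℝ ∞ f) (j : Fin 2) :
    ContDiff ℝ ∞ (partialDeriv j f) :=
  (hf.fderiv_right (m := ∞) (by simp)).clm_apply contDiff_const

lemma tsupport_partialDeriv_subset (f : Plane → ℂ) (j : Fin 2) :
    tsupport (partialDeriv j f) ⊆ tsupport f :=
  tsupport_fderiv_apply_subset ℝ _

lemma hasCompactSupport_partialDeriv {f : Plane → ℂ} (hf : HasCompactSupport f) (j : Fin 2) :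
    HasCompactSupport (partialDeriv j f) :=
  hf.fderiv_apply (𝕜 := ℝ) _

lemma partialDeriv_mul {f g : Plane → ℂ} (hf : ContDiff ℝ ∞ f) (hg : ContDiff ℝ ∞ g) (j : Fin 2)
    (x : Plane) : partialDeriv j (fun y => f y * g y) x =
      partialDeriv j f x * g x + f x * partialDeriv j g x := by
  have := fderiv_fun_mul (hf.differentiable (by simp) x) (hg.differentiable (by simp) x)
  simp only [partialDeriv, this]
  simp; ring

lemma partialDeriv_sum {ι : Type*} (s : Finset ι) {f : ι → Plane → ℂ}
    (hf : ∀ i, ContDiff ℝ ∞ (f i)) (j : Fin 2) (x : Plane) :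
    partialDeriv j (fun y => ∑ i ∈ s, f i y) x =
      ∑ i ∈ s, partialDeriv j (f i) x := by
  simp only [partialDeriv]
  rw [fderiv_fun_sum fun i _ => (hf i).differentiable (by simp) x]
  simp

/-- The distribution `χ ↦ ∫_Ω (χ h₀ + ∑ⱼ ∂ⱼχ hⱼ) - ∫_∂Ω χ b`. -/
def localForm (Ω : Set Plane) (h₀ : Plane → ℂ) (h : Fin 2 → Plane → ℂ) (b χ : Plane → ℂ) : ℂ :=
  (∫ x in Ω, χ x * h₀ x) + (∑ j, ∫ x in Ω, partialDeriv j χ x * h j x)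
    - ∫ x, χ x * b x ∂(boundaryMeasure Ω)

lemma exists_bound_of_hasCompactSupport {χ : Plane → ℂ} (hc : Continuous χ)
    (hs : HasCompactSupport χ) : ∃ C, ∀ x, ‖χ x‖ ≤ C :=
  hs.exists_bound_of_continuous hc

lemma integrable_continuous_mul {μ : Measure Plane} {χ h : Plane → ℂ} (hh : Integrable h μ)
    (hc : Continuous χ) (hs : HasCompactSupport χ) : Integrable (fun x => χ x * h x) μ := by
  obtain ⟨C, hC⟩ := exists_bound_of_hasCompactSupport hc hs
  exact hh.bdd_mul hc.aestronglyMeasurable (Eventually.of_forall hC)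

/-- A functional that vanishes locally in an open set vanishes on test functions supported there. -/
lemma eq_zero_of_locally_eq_zero (L : (Plane → ℂ) → ℂ)
    (hL : ∀ (ι : Type) (s : Finset ι) (F : ι → Plane → ℂ), (∀ i, ContDiff ℝ ∞ (F i)) →
      (∀ i, HasCompactSupport (F i)) → L (fun x => ∑ i ∈ s, F i x) = ∑ i ∈ s, L (F i))
    {W : Set Plane} (hloc : ∀ x ∈ W, ∃ U, IsOpen U ∧ x ∈ U ∧ ∀ χ, ContDiff ℝ ∞ χ →
      HasCompactSupport χ → tsupport χ ⊆ U → L χ = 0)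
    {χ : Plane → ℂ} (hχ : ContDiff ℝ ∞ χ) (hc : HasCompactSupport χ) (hs : tsupport χ ⊆ W) :
    L χ = 0 := by
  choose! U hUo hxU hU using hloc
  obtain ⟨t, ht⟩ := hc.isCompact.elim_finite_subcover (fun x : W => U x)
    (fun x => hUo x x.2) (fun x hx => Set.mem_iUnion.2 ⟨⟨x, hs hx⟩, hxU x (hs hx)⟩)
  obtain ⟨ρ, hρ⟩ := SmoothPartitionOfUnity.exists_isSubordinate (modelWithCornersSelf ℝ Plane)
    (isClosed_tsupport χ) (fun i : Fin t.card => U (t.equivFin.symm i))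
    (fun i => hUo _ (t.equivFin.symm i).1.2) (fun x hx => by
      obtain ⟨y, hy, hxy⟩ := Set.mem_iUnion₂.1 (ht hx)
      exact Set.mem_iUnion.2 ⟨t.equivFin ⟨y, hy⟩, by simpa using hxy⟩)
  have hsum : χ = fun x => ∑ i ∈ Finset.univ, (ρ i x : ℂ) * χ x := by
    funext x
    by_cases hx : x ∈ tsupport χ
    · have := ρ.sum_eq_one hx
      rw [finsum_eq_sum_of_fintype] at this
      rw [← Finset.sum_mul, ← Complex.ofReal_sum, this]
      simp
    · simp [image_eq_zero_of_notMem_tsupport hx]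
  have hρs : ∀ i, ContDiff ℝ ∞ fun x => (ρ i x : ℂ) := fun i =>
    Complex.ofRealCLM.contDiff.comp (ρ i).contMDiff.contDiff
  rw [hsum, hL _ _ _ (fun i => (hρs i).mul hχ) (fun i => hc.mul_left)]
  refine Finset.sum_eq_zero fun i _ => ?_
  refine hU _ (t.equivFin.symm i).1.2 _ ((hρs i).mul hχ) hc.mul_left ?_
  refine (tsupport_mul_subset_left).trans (subset_trans ?_ (hρ i))
  refine closure_mono fun x hx => ?_
  simpa using hx

variable {Ω V : Set Plane} {h₀ b : Plane → ℂ} {h : Fin 2 → Plane → ℂ}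

lemma IsPiecewiseFlat.isFiniteMeasure_volume (hΩ : IsPiecewiseFlat Ω V) :
    IsFiniteMeasure (volume.restrict Ω) :=
  ⟨by rw [Measure.restrict_apply_univ]; exact hΩ.isBounded.measure_lt_top⟩

lemma IsPiecewiseFlat.isFiniteMeasure_boundary (hΩ : IsPiecewiseFlat Ω V) :
    IsFiniteMeasure (boundaryMeasure Ω) := ⟨hΩ.boundary_lt_top⟩

lemma boundaryMeasure_noAtoms (Ω : Set Plane) : NullSingletonClass (boundaryMeasure Ω) := by
  have : NullSingletonClass (Measure.hausdorffMeasure 1 : Measure Plane) :=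
    Measure.nullSingletonClass_hausdorff Plane one_pos
  exact Measure.restrict.instNullSingletonClass _

lemma localForm_sum [IsFiniteMeasure (volume.restrict Ω)] (hh₀ : IntegrableOn h₀ Ω)
    (hh : ∀ j, MemLp (h j) 2 (volume.restrict Ω)) (hb : Integrable b (boundaryMeasure Ω))
    {ι : Type*} (s : Finset ι) (F : ι → Plane → ℂ) (hF : ∀ i, ContDiff ℝ ∞ (F i))
    (hc : ∀ i, HasCompactSupport (F i)) :
    localForm Ω h₀ h b (fun x => ∑ i ∈ s, F i x) = ∑ i ∈ s, localForm Ω h₀ h b (F i) := by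
  simp only [localForm, partialDeriv_sum s hF, Finset.sum_mul, Finset.sum_sub_distrib,
    Finset.sum_add_distrib]
  rw [integral_finsetSum s fun i _ => integrable_continuous_mul hh₀ (hF i).continuous (hc i),
    integral_finsetSum s fun i _ => integrable_continuous_mul hb (hF i).continuous (hc i)]
  congr 2
  rw [Finset.sum_comm]
  refine Finset.sum_congr rfl fun j _ => ?_
  exact integral_finsetSum s fun i _ => integrable_continuous_mul
    ((hh j).integrable (by norm_num)) (continuous_partialDeriv (hF i) j) (hasCompactSupport_partialDeriv (hc i) j)

/-! ### Removability of points by shrinking cutoffs. -/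

/-- A fixed smooth bump function around the origin. -/
def bump (x : Plane) : ℂ := ((⟨1, 2, one_pos, one_lt_two⟩ : ContDiffBump (0 : Plane)) x : ℂ)

lemma contDiff_bump : ContDiff ℝ ∞ bump :=
  Complex.ofRealCLM.contDiff.comp (ContDiffBump.contDiff _)

lemma bump_eq_one {x : Plane} (hx : ‖x‖ ≤ 1) : bump x = 1 := by
  rw [bump, ContDiffBump.one_of_mem_closedBall _ (by simpa using hx)]; rfl

lemma bump_eq_zero {x : Plane} (hx : 2 ≤ ‖x‖) : bump x = 0 := by
  rw [bump, ContDiffBump.zero_of_le_dist _ (by simpa using hx)]; rfl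

lemma norm_bump_le (x : Plane) : ‖bump x‖ ≤ 1 := by
  rw [bump, Complex.norm_real, Real.norm_eq_abs, abs_of_nonneg (ContDiffBump.nonneg _)]
  exact ContDiffBump.le_one _

lemma hasCompactSupport_bump : HasCompactSupport bump :=
  (ContDiffBump.hasCompactSupport _).comp_left (g := ((↑) : ℝ → ℂ)) Complex.ofReal_zero

/-- The bump function shrunk by the factor `n + 1` and centred at `v`. -/
def shrunkBump (v : Plane) (n : ℕ) (x : Plane) : ℂ := bump (((n : ℝ) + 1) • (x - v))

lemma contDiff_shrunkBump (v : Plane) (n : ℕ) : ContDiff ℝ ∞ (shrunkBump v n) :=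
  contDiff_bump.comp (by fun_prop)

lemma norm_smul_succ (n : ℕ) (y : Plane) : ‖((n : ℝ) + 1) • y‖ = ((n : ℝ) + 1) * ‖y‖ := by
  rw [norm_smul, Real.norm_eq_abs, abs_of_pos (by positivity)]

lemma shrunkBump_eventually_zero {v x : Plane} (hx : x ≠ v) :
    ∀ᶠ n : ℕ in atTop, 2 / ((n : ℝ) + 1) < ‖x - v‖ := by
  have h : Tendsto (fun n : ℕ => 2 / ((n : ℝ) + 1)) atTop (𝓝 0) := by
    have := (tendsto_one_div_add_atTop_nhds_zero_nat (𝕜 := ℝ)).const_mul 2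
    simpa [div_eq_mul_inv] using this
  exact h.eventually (gt_mem_nhds (norm_pos_iff.2 (sub_ne_zero.2 hx)))

lemma shrunkBump_eq_zero {v x : Plane} {n : ℕ} (hx : 2 / ((n : ℝ) + 1) ≤ ‖x - v‖) :
    shrunkBump v n x = 0 := by
  refine bump_eq_zero ?_
  rw [norm_smul_succ]
  rw [div_le_iff₀ (by positivity)] at hx
  linarith

lemma shrunkBump_eventuallyEq_one (v : Plane) (n : ℕ) : shrunkBump v n =ᶠ[𝓝 v] 1 := by
  have hc : Continuous fun x : Plane => ‖((n : ℝ) + 1) • (x - v)‖ := by fun_prop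
  have := hc.tendsto v
  simp only [sub_self, smul_zero, norm_zero] at this
  filter_upwards [this.eventually (gt_mem_nhds one_pos)] with x hx
  exact bump_eq_one hx.le

lemma norm_shrunkBump_le (v : Plane) (n : ℕ) (x : Plane) : ‖shrunkBump v n x‖ ≤ 1 :=
  norm_bump_le _

lemma partialDeriv_shrunkBump (v : Plane) (n : ℕ) (j : Fin 2) (x : Plane) :
    partialDeriv j (shrunkBump v n) x =
      ((n : ℂ) + 1) * partialDeriv j bump (((n : ℝ) + 1) • (x - v)) := by
  have h1 : HasFDerivAt (fun x : Plane => ((n : ℝ) + 1) • (x - v))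
      (((n : ℝ) + 1) • ContinuousLinearMap.id ℝ Plane) x :=
    ((hasFDerivAt_id (𝕜 := ℝ) x).sub_const v).fun_const_smul ((n : ℝ) + 1)
  have h2 := ((contDiff_bump.differentiable (by simp)) (((n : ℝ) + 1) • (x - v))).hasFDerivAt.comp
    x h1
  have h3 : fderiv ℝ (shrunkBump v n) x = _ := h2.fderiv
  simp [partialDeriv, h3]

lemma tsupport_shrunkBump_subset (v : Plane) (n : ℕ) :
    tsupport (shrunkBump v n) ⊆ Metric.closedBall v (2 / ((n : ℝ) + 1)) := by
  refine closure_minimal (fun x hx => ?_) Metric.isClosed_closedBall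
  rw [mem_closedBall_iff_norm]
  by_contra! hlt
  exact hx (shrunkBump_eq_zero hlt.le)

lemma tendsto_integral_shrunkBump_mul {μ : Measure Plane} [NullSingletonClass μ] {g : Plane → ℂ}
    (hg : Integrable g μ) (v : Plane) :
    Tendsto (fun n => ∫ x, shrunkBump v n x * g x ∂μ) atTop (𝓝 0) := by
  rw [← integral_zero Plane ℂ (μ := μ)]
  refine tendsto_integral_of_dominated_convergence (fun x => ‖g x‖)
    (fun n => (contDiff_shrunkBump v n).continuous.aestronglyMeasurable.mul hg.1) hg.norm
    (fun n => Eventually.of_forall fun x => ?_) ?_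
  · rw [norm_mul]
    exact mul_le_of_le_one_left (norm_nonneg _) (norm_shrunkBump_le v n x)
  · have : ∀ᵐ x ∂μ, x ≠ v := by simp [ae_iff]
    filter_upwards [this] with x hx
    refine tendsto_const_nhds.congr' ?_
    filter_upwards [shrunkBump_eventually_zero hx] with n hn
    rw [shrunkBump_eq_zero hn.le, zero_mul]

/-- Two dimensions are critical here: the gradient has size of order `n + 1` on a disc of radius `2
/ (n + 1)`, so its `L²` norm stays bounded although it blows up pointwise. -/
lemma exists_eLpNorm_partialDeriv_shrunkBump_le (v : Plane) (j : Fin 2) :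
    ∃ C : ℝ≥0∞, C ≠ ⊤ ∧ ∀ n, eLpNorm (partialDeriv j (shrunkBump v n)) 2 volume ≤ C := by
  obtain ⟨C, hC⟩ := exists_bound_of_hasCompactSupport (continuous_partialDeriv contDiff_bump j)
    (hasCompactSupport_partialDeriv hasCompactSupport_bump j)
  have hC0 : 0 ≤ C := (norm_nonneg _).trans (hC 0)
  refine ⟨(volume (Metric.ball (0 : Plane) 1)) ^ (1 / 2 : ℝ) * ENNReal.ofReal (2 * C),
    ENNReal.mul_ne_top (ENNReal.rpow_ne_top_of_nonneg (by norm_num) measure_ball_lt_top.ne)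
      ENNReal.ofReal_ne_top, fun n => ?_⟩
  set r : ℝ := 2 / ((n : ℝ) + 1) with hr
  have hr0 : 0 ≤ r := by positivity
  have hsupp : Function.support (partialDeriv j (shrunkBump v n)) ⊆ Metric.closedBall v r :=
    (subset_tsupport _).trans ((tsupport_partialDeriv_subset _ j).trans
      (tsupport_shrunkBump_subset v n))
  rw [← Set.indicator_eq_self.2 hsupp,
    eLpNorm_indicator_eq_eLpNorm_restrict Metric.isClosed_closedBall.measurableSet]
  refine (eLpNorm_le_of_ae_bound (C := ((n : ℝ) + 1) * C) (Eventually.of_forall fun x => ?_)).trans ?_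
  · rw [partialDeriv_shrunkBump, norm_mul]
    have : ‖(n : ℂ) + 1‖ = (n : ℝ) + 1 := by
      rw [← Nat.cast_succ, Complex.norm_natCast]; simp
    rw [this]
    exact mul_le_mul_of_nonneg_left (hC _) (by positivity)
  · rw [Measure.restrict_apply_univ, Measure.addHaar_closedBall _ _ hr0, finrank_euclideanSpace_fin,
      ENNReal.mul_rpow_of_nonneg _ _ (by norm_num), ENNReal.ofReal_rpow_of_nonneg (by positivity)
      (by norm_num)]
    have h1 : (r ^ 2) ^ ((2 : ℝ≥0∞).toReal⁻¹) = r := by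
      rw [ENNReal.toReal_ofNat, ← Real.rpow_natCast_mul hr0]; norm_num
    rw [h1, mul_comm (ENNReal.ofReal r), mul_assoc, ← ENNReal.ofReal_mul hr0]
    refine le_of_eq ?_
    congr 2
    · simp
    · rw [hr]; field_simp

/-- The cutoff gradients are only bounded in `L²`. The decay comes from `g`, whose `L²` norm over
the shrinking discs tends to zero. -/
lemma tendsto_integral_partialDeriv_shrunkBump_mul {g : Plane → ℂ}
    (hg : MemLp g 2 (volume.restrict Ω)) (v : Plane) (j : Fin 2) :
    Tendsto (fun n => ∫ x in Ω, partialDeriv j (shrunkBump v n) x * g x) atTop (𝓝 0) := by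
  obtain ⟨C, hC, hle⟩ := exists_eLpNorm_partialDeriv_shrunkBump_le v j
  set B : ℕ → Set Plane := fun n => Metric.closedBall v (2 / ((n : ℝ) + 1)) with hB
  have hBm : ∀ n, MeasurableSet (B n) := fun n => Metric.isClosed_closedBall.measurableSet
  have hG : ∀ n, MemLp ((B n).indicator g) 2 (volume.restrict Ω) := fun n => hg.indicator (hBm n)
  have h1 : Tendsto (fun n => eLpNorm (fun x => (B n).indicator g x - (0 : Plane → ℂ) x) 2
      (volume.restrict Ω)) atTop (𝓝 0) := by
    refine tendsto_eLpNorm_two_of_dominated (G := fun x => ‖g x‖) (fun n => (hG n).1)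
      aestronglyMeasurable_zero hg.norm
      (fun n => Eventually.of_forall fun x => norm_indicator_le_norm_self _ _) ?_
    have : ∀ᵐ x ∂(volume.restrict Ω), x ≠ v := by simp [ae_iff]
    filter_upwards [this] with x hx
    refine tendsto_const_nhds.congr' ?_
    filter_upwards [shrunkBump_eventually_zero hx] with n hn
    rw [Set.indicator_of_notMem]
    · rfl
    · rw [hB, mem_closedBall_iff_norm]
      exact not_le.2 hn
  simp only [Pi.zero_apply, sub_zero] at h1
  have h2 := ENNReal.Tendsto.const_mul h1 (Or.inr hC)
  rw [mul_zero] at h2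
  rw [tendsto_zero_iff_enorm_tendsto_zero]
  refine tendsto_of_tendsto_of_tendsto_of_le_of_le tendsto_const_nhds h2
    (fun _ => zero_le) fun n => ?_
  have e : ∀ x, partialDeriv j (shrunkBump v n) x * g x =
      partialDeriv j (shrunkBump v n) x * (B n).indicator g x := fun x => by
    by_cases hx : x ∈ B n
    · rw [Set.indicator_of_mem hx]
    · rw [partialDeriv_eq_zero_of_notMem j fun h => hx (tsupport_shrunkBump_subset v n h),
        zero_mul, zero_mul]
  have hmem : MemLp (partialDeriv j (shrunkBump v n)) 2 (volume.restrict Ω) :=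
    ⟨(continuous_partialDeriv (contDiff_shrunkBump v n) j).aestronglyMeasurable,
      ((eLpNorm_mono_measure _ Measure.restrict_le_self).trans (hle n)).trans_lt hC.lt_top⟩
  simp only [e]
  refine (norm_integral_mul_le hmem (hG n)).trans ?_
  gcongr
  exact (eLpNorm_mono_measure _ Measure.restrict_le_self).trans (hle n)

lemma memLp_continuous_mul {μ : Measure Plane} {χ g : Plane → ℂ} (hg : MemLp g 2 μ)
    (hc : Continuous χ) (hs : HasCompactSupport χ) : MemLp (fun x => χ x * g x) 2 μ := by
  obtain ⟨C, hC⟩ := exists_bound_of_hasCompactSupport hc hs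
  refine MemLp.of_le_mul hg (hc.aestronglyMeasurable.mul hg.1) (c := C) (Eventually.of_forall ?_)
  intro x
  rw [norm_mul]
  exact mul_le_mul_of_nonneg_right (hC x) (norm_nonneg _)

lemma tendsto_localForm_mul_shrunkBump [IsFiniteMeasure (volume.restrict Ω)]
    (hh₀ : IntegrableOn h₀ Ω)
    (hh : ∀ j, MemLp (h j) 2 (volume.restrict Ω)) (hb : Integrable b (boundaryMeasure Ω))
    {χ : Plane → ℂ} (hχ : ContDiff ℝ ∞ χ) (hc : HasCompactSupport χ) (v : Plane) :
    Tendsto (fun n => localForm Ω h₀ h b fun x => shrunkBump v n x * χ x) atTop (𝓝 0) := by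
  have : NullSingletonClass (boundaryMeasure Ω) := boundaryMeasure_noAtoms Ω
  have t0 := tendsto_integral_shrunkBump_mul (integrable_continuous_mul hh₀ hχ.continuous hc) v
  have t3 := tendsto_integral_shrunkBump_mul (integrable_continuous_mul hb hχ.continuous hc) v
  have tj : ∀ j, Tendsto (fun n => ∫ x in Ω, partialDeriv j (fun x => shrunkBump v n x * χ x) x
      * h j x) atTop (𝓝 0) := by
    intro j
    have m1 := memLp_continuous_mul (hh j) hχ.continuous hc
    have m2 := memLp_continuous_mul (hh j) (continuous_partialDeriv hχ j)
      (hasCompactSupport_partialDeriv hc j)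
    have s1 := tendsto_integral_partialDeriv_shrunkBump_mul m1 v j
    have s2 := tendsto_integral_shrunkBump_mul (m2.integrable (by norm_num)) v
    have s3 := s1.add s2
    rw [add_zero] at s3
    refine s3.congr fun n => ?_
    have hsc : HasCompactSupport (shrunkBump v n) :=
      (isCompact_closedBall v (2 / ((n : ℝ) + 1))).of_isClosed_subset (isClosed_tsupport _)
        (tsupport_shrunkBump_subset v n)
    rw [← integral_add]
    · refine integral_congr_ae (Eventually.of_forall fun x => ?_)
      simp only [partialDeriv_mul (contDiff_shrunkBump v n) hχ]
      ring
    · exact integrable_continuous_mul (m1.integrable (by norm_num))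
        (continuous_partialDeriv (contDiff_shrunkBump v n) j) (hasCompactSupport_partialDeriv hsc j)
    · exact integrable_continuous_mul (m2.integrable (by norm_num))
        (contDiff_shrunkBump v n).continuous hsc
  have t := (t0.add (tendsto_finsetSum Finset.univ fun j _ => tj j)).sub t3
  simpa [localForm, mul_assoc] using t

/-- Split `χ` with the cutoff `ρₙ` at `v` into `ρₙ χ + (1 - ρₙ) χ`. The second part vanishes near
`v`, so the form kills it. The first contributes a quantity tending to zero, while the sum does not
depend on `n`. -/
lemma localForm_eq_zero_of_away [IsFiniteMeasure (volume.restrict Ω)]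
    (hh₀ : IntegrableOn h₀ Ω)
    (hh : ∀ j, MemLp (h j) 2 (volume.restrict Ω)) (hb : Integrable b (boundaryMeasure Ω))
    {U : Set Plane} {v : Plane} (haway : ∀ χ, ContDiff ℝ ∞ χ → HasCompactSupport χ →
      tsupport χ ⊆ U \ {v} → localForm Ω h₀ h b χ = 0)
    {χ : Plane → ℂ} (hχ : ContDiff ℝ ∞ χ) (hc : HasCompactSupport χ) (hs : tsupport χ ⊆ U) :
    localForm Ω h₀ h b χ = 0 := by
  refine tendsto_nhds_unique (tendsto_const_nhds.congr fun n => ?_)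
    (tendsto_localForm_mul_shrunkBump hh₀ hh hb hχ hc v)
  set F : Fin 2 → Plane → ℂ := ![fun x => shrunkBump v n x * χ x,
    fun x => (1 - shrunkBump v n x) * χ x] with hF
  have hFs : ∀ i, ContDiff ℝ ∞ (F i) := by
    have := contDiff_shrunkBump v n
    intro i
    fin_cases i
    · exact this.mul hχ
    · exact (contDiff_const.sub this).mul hχ
  have hFc : ∀ i, HasCompactSupport (F i) := by
    intro i
    fin_cases i
    · exact hc.mul_left
    · exact hc.mul_left
  have h1 := localForm_sum hh₀ hh hb Finset.univ F hFs hFc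
  have h2 : (fun x => ∑ i, F i x) = χ := by
    funext x; simp [hF, Fin.sum_univ_two]; ring
  rw [h2, Fin.sum_univ_two] at h1
  have h3 : localForm Ω h₀ h b (F 1) = 0 := by
    refine haway _ (hFs 1) (hFc 1) fun x hx => ⟨hs (tsupport_mul_subset_right hx), ?_⟩
    rintro rfl
    refine notMem_tsupport_iff_eventuallyEq.2 ?_ hx
    filter_upwards [shrunkBump_eventuallyEq_one x n] with y hy
    simp [hF, hy]
  rw [h1, h3, add_zero]
  rfl

/-- An integral identity on a polygon follows from its local versions outside the vertices. -/
theorem IsPiecewiseFlat.integral_eq_of_local (hΩ : IsPiecewiseFlat Ω V)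
    (hh₀ : IntegrableOn h₀ Ω)
    (hh : ∀ j, MemLp (h j) 2 (volume.restrict Ω)) (hb : Integrable b (boundaryMeasure Ω))
    (hloc : ∀ U ν, IsFlatPatch Ω U ν → ∀ χ, ContDiff ℝ ∞ χ →
      HasCompactSupport χ → tsupport χ ⊆ U → localForm Ω h₀ h b χ = 0) :
    ∫ x in Ω, h₀ x = ∫ x, b x ∂(boundaryMeasure Ω) := by
  have := hΩ.isFiniteMeasure_volume
  have hadd : ∀ (ι : Type) (s : Finset ι) (F : ι → Plane → ℂ), (∀ i, ContDiff ℝ ∞ (F i)) →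
      (∀ i, HasCompactSupport (F i)) → localForm Ω h₀ h b (fun x => ∑ i ∈ s, F i x) =
        ∑ i ∈ s, localForm Ω h₀ h b (F i) :=
    fun ι s F h1 h2 => localForm_sum hh₀ hh hb s F h1 h2
  have hVc : ∀ χ, ContDiff ℝ ∞ χ → HasCompactSupport χ → tsupport χ ⊆ Vᶜ →
      localForm Ω h₀ h b χ = 0 := fun χ h1 h2 h3 =>
    eq_zero_of_locally_eq_zero _ hadd (fun x hx => by
      obtain ⟨U, ν, hxU, hU⟩ := hΩ.exists_isFlatPatch hx
      exact ⟨U, hU.isOpen, hxU, hloc U ν hU⟩) h1 h2 h3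
  have hall : ∀ χ, ContDiff ℝ ∞ χ → HasCompactSupport χ → localForm Ω h₀ h b χ = 0 := by
    refine fun χ h1 h2 => eq_zero_of_locally_eq_zero _ hadd (W := Set.univ) (fun x _ => ?_) h1 h2
      (Set.subset_univ _)
    -- Near any point `x` all points of `V` other than `x` can be excluded, so only the single point
    -- `x` has to be removed at a time.
    refine ⟨(V \ {x})ᶜ, (hΩ.finite.subset Set.sdiff_subset).isClosed.isOpen_compl, by simp,
      fun χ' g1 g2 g3 => localForm_eq_zero_of_away hh₀ hh hb (v := x) (fun χ'' k1 k2 k3 =>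
        hVc χ'' k1 k2 fun y hy hyV => ?_) g1 g2 g3⟩
    exact (k3 hy).1 ⟨hyV, (k3 hy).2⟩
  -- Testing with a function equal to `1` on the closure turns the vanishing of the form into the
  -- integral identity: its gradient is zero in `Ω`. The maximum with `1` keeps the inner radius
  -- positive even when `Ω` is empty.
  obtain ⟨R, hR⟩ := hΩ.isBounded.closure.subset_ball 0
  have hR0 : (0 : ℝ) < max R 1 := lt_max_of_lt_right one_pos
  let β : ContDiffBump (0 : Plane) := ⟨max R 1, max R 1 + 1, hR0, by linarith⟩
  have hβ1 : ∀ x ∈ closure Ω, (β x : ℂ) = 1 := fun x hx => by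
    rw [β.one_of_mem_closedBall (Metric.ball_subset_closedBall
      (Metric.ball_subset_ball (le_max_left _ _) (hR hx)))]
    rfl
  have key := hall (fun x => (β x : ℂ)) (Complex.ofRealCLM.contDiff.comp β.contDiff)
    (β.hasCompactSupport.comp_left (g := ((↑) : ℝ → ℂ)) Complex.ofReal_zero)
  have hm := hΩ.isOpen.measurableSet
  have e0 : ∫ x in Ω, (β x : ℂ) * h₀ x = ∫ x in Ω, h₀ x :=
    setIntegral_congr_fun hm fun x hx => by simp only [hβ1 x (subset_closure hx), one_mul]
  have e1 : ∀ j, ∫ x in Ω, partialDeriv j (fun x => (β x : ℂ)) x * h j x = 0 := fun j => by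
    refine setIntegral_eq_zero_of_forall_eq_zero fun x hx => ?_
    have : (fun x => (β x : ℂ)) =ᶠ[𝓝 x] fun _ => 1 := by
      filter_upwards [hΩ.isOpen.mem_nhds hx] with y hy using hβ1 y (subset_closure hy)
    rw [partialDeriv, this.fderiv_eq]
    simp
  have e2 : ∫ x, (β x : ℂ) * b x ∂(boundaryMeasure Ω) = ∫ x, b x ∂(boundaryMeasure Ω) :=
    setIntegral_congr_fun isClosed_frontier.measurableSet fun x hx => by
      simp only [hβ1 x (frontier_subset_closure hx), one_mul]
  rw [localForm, e0, e2] at key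
  simpa [e1, sub_eq_zero] using key

end Localization

/-! ### Scalar Sobolev functions with a boundary trace -/

/-- Convergence in `L²(μ)`. -/
def TendstoL2 (μ : Measure Plane) (F : ℕ → Plane → ℂ) (f : Plane → ℂ) : Prop :=
  Tendsto (fun k => eLpNorm (fun x => F k x - f x) 2 μ) atTop (𝓝 0)

/-- `f ∈ L²(Ω)` has the gradient `D` and the boundary trace `g`, in the sense of approximation by
smooth functions. -/
structure HasTrace (Ω : Set Plane) (f : Plane → ℂ) (D : Fin 2 → Plane → ℂ) (g : Plane → ℂ) :
    Prop where
  memLp : MemLp f 2 (volume.restrict Ω)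
  memLp_deriv : ∀ j, MemLp (D j) 2 (volume.restrict Ω)
  memLp_trace : MemLp g 2 (boundaryMeasure Ω)
  exists_approx : ∃ φ : ℕ → Plane → ℂ, (∀ k, ContDiff ℝ ∞ (φ k)) ∧
    TendstoL2 (volume.restrict Ω) φ f ∧
    (∀ j, TendstoL2 (volume.restrict Ω) (fun k => partialDeriv j (φ k)) (D j)) ∧
    TendstoL2 (boundaryMeasure Ω) φ g

variable {Ω V U : Set Plane} {ν : Plane} {f f' g g' χ ψ : Plane → ℂ} {D D' : Fin 2 → Plane → ℂ}

lemma IsPiecewiseFlat.memLp_of_continuous (hΩ : IsPiecewiseFlat Ω V) (hf : Continuous f) :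
    MemLp f 2 (volume.restrict Ω) := by
  have := hΩ.isFiniteMeasure_volume
  obtain ⟨C, hC⟩ := hΩ.isBounded.isCompact_closure.exists_bound_of_continuousOn hf.continuousOn
  exact MemLp.of_bound hf.aestronglyMeasurable C ((ae_restrict_iff' hΩ.isOpen.measurableSet).2
    (Eventually.of_forall fun x hx => hC x (subset_closure hx)))

lemma IsPiecewiseFlat.memLp_boundary_of_continuous (hΩ : IsPiecewiseFlat Ω V) (hf : Continuous f) :
    MemLp f 2 (boundaryMeasure Ω) := by
  have := hΩ.isFiniteMeasure_boundary
  obtain ⟨C, hC⟩ := hΩ.isBounded.isCompact_closure.exists_bound_of_continuousOn hf.continuousOn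
  exact MemLp.of_bound hf.aestronglyMeasurable C
    ((ae_restrict_iff' isClosed_frontier.measurableSet).2
    (Eventually.of_forall fun x hx => hC x (frontier_subset_closure hx)))

/-- The Gauss-Green formula for a Sobolev function times a smooth test function. -/
lemma HasTrace.gaussGreen (hΩ : IsPiecewiseFlat Ω V) (hU : IsFlatPatch Ω U ν)
    (hf : HasTrace Ω f D g) (hψ : ContDiff ℝ ∞ ψ) (hc : HasCompactSupport ψ) (hs : tsupport ψ ⊆ U)
    (j : Fin 2) :
    (∫ x in Ω, D j x * ψ x) + ∫ x in Ω, f x * partialDeriv j ψ x =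
      (ν j : ℂ) * ∫ x, g x * ψ x ∂(boundaryMeasure Ω) := by
  obtain ⟨φ, hφ, h1, h2, h3⟩ := hf.exists_approx
  have mψ := hΩ.memLp_of_continuous hψ.continuous
  have mψ' := hΩ.memLp_of_continuous (continuous_partialDeriv hψ j)
  have mb := hΩ.memLp_boundary_of_continuous hψ.continuous
  have mφ := fun k => hΩ.memLp_of_continuous (hφ k).continuous
  have mφ' := fun k => hΩ.memLp_of_continuous (continuous_partialDeriv (hφ k) j)
  have t1 := tendsto_integral_mul_of_eLpNorm mφ' (hf.memLp_deriv j) mψ (h2 j)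
  have t2 := tendsto_integral_mul_of_eLpNorm mφ hf.memLp mψ' h1
  have t3 := tendsto_integral_mul_of_eLpNorm
    (fun k => hΩ.memLp_boundary_of_continuous (hφ k).continuous) hf.memLp_trace mb h3
  refine tendsto_nhds_unique (t1.add t2) ((t3.const_mul (ν j : ℂ)).congr fun k => ?_)
  rw [← integral_add (integrable_mul_two (mφ' k) mψ) (integrable_mul_two (mφ k) mψ')]
  have h := hU.gaussGreen (fun x => φ k x * ψ x) ((hφ k).mul hψ) hc.mul_left
    (tsupport_mul_subset_right.trans hs) j
  rw [← h]
  exact integral_congr_ae (Eventually.of_forall fun x => partialDeriv_mul (hφ k) hψ j x)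

/-- The Gauss-Green formula for a product of Sobolev functions. -/
lemma HasTrace.gaussGreen_mul (hΩ : IsPiecewiseFlat Ω V) (hU : IsFlatPatch Ω U ν)
    (hf : HasTrace Ω f D g) (hf' : HasTrace Ω f' D' g') (hχ : ContDiff ℝ ∞ χ)
    (hc : HasCompactSupport χ) (hs : tsupport χ ⊆ U) (j : Fin 2) :
    (∫ x in Ω, χ x * (D j x * f' x + f x * D' j x)) + ∫ x in Ω, partialDeriv j χ x * (f x * f' x) =
      (ν j : ℂ) * ∫ x, χ x * (g x * g' x) ∂(boundaryMeasure Ω) := by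
  obtain ⟨φ, hφ, h1, h2, h3⟩ := hf'.exists_approx
  have hc' := hasCompactSupport_partialDeriv hc j
  have hχ' := continuous_partialDeriv hχ j
  have m1 := memLp_continuous_mul (hf.memLp_deriv j) hχ.continuous hc
  have m2 := memLp_continuous_mul hf.memLp hχ.continuous hc
  have m3 := memLp_continuous_mul hf.memLp hχ' hc'
  have m4 := memLp_continuous_mul hf.memLp_trace hχ.continuous hc
  have mφ := fun k => hΩ.memLp_of_continuous (hφ k).continuous
  have mφ' := fun k => hΩ.memLp_of_continuous (continuous_partialDeriv (hφ k) j)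
  have t1 := tendsto_integral_mul_of_eLpNorm mφ hf'.memLp m1 h1
  have t2 := tendsto_integral_mul_of_eLpNorm mφ' (hf'.memLp_deriv j) m2 (h2 j)
  have t3 := tendsto_integral_mul_of_eLpNorm mφ hf'.memLp m3 h1
  have t4 := tendsto_integral_mul_of_eLpNorm
    (fun k => hΩ.memLp_boundary_of_continuous (hφ k).continuous) hf'.memLp_trace m4 h3
  have i12 : ∀ k, Integrable (fun x => φ k x * (χ x * D j x) +
      partialDeriv j (φ k) x * (χ x * f x)) (volume.restrict Ω) := fun k =>
    (integrable_mul_two (mφ k) m1).add (integrable_mul_two (mφ' k) m2)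
  have key := tendsto_nhds_unique ((t1.add t2).add t3)
    ((t4.const_mul (ν j : ℂ)).congr fun k => by
      rw [← integral_add (integrable_mul_two (mφ k) m1) (integrable_mul_two (mφ' k) m2),
        ← integral_add (i12 k) (integrable_mul_two (mφ k) m3)]
      -- Only `f'` is approximated: `χ φₖ` is then an admissible test function for the formula
      -- already known for `f`.
      have h := hf.gaussGreen hΩ hU (hχ.mul (hφ k)) hc.mul_right
        (tsupport_mul_subset_left.trans hs) j
      have e : ∀ x, φ k x * (χ x * g x) = g x * (χ x * φ k x) := fun x => by ring
      simp only [e]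
      rw [← h, ← integral_add]
      · refine integral_congr_ae (Eventually.of_forall fun x => ?_)
        simp only [partialDeriv_mul hχ (hφ k) j x]
        ring
      · exact integrable_mul_two (hf.memLp_deriv j)
          (hΩ.memLp_of_continuous (hχ.mul (hφ k)).continuous)
      · exact integrable_mul_two hf.memLp
          (hΩ.memLp_of_continuous (continuous_partialDeriv (hχ.mul (hφ k)) j)))
  rw [← integral_add (integrable_mul_two hf'.memLp m1)
    (integrable_mul_two (hf'.memLp_deriv j) m2)] at key
  convert key using 2
  · congr 1; funext x; ring_nf
  · congr 1; funext x; ring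
  · congr 1; funext x; ring

/-! ### The area form as a null Lagrangian. -/

/-- The weak form of `∫ d(χ f) ∧ df'` for functions with the gradients `D` and `D'`. -/
def bracketForm (Ω : Set Plane) (χ f : Plane → ℂ) (D D' : Fin 2 → Plane → ℂ) : ℂ :=
  (∫ x in Ω, D 0 x * (χ x * D' 1 x)) - (∫ x in Ω, D 1 x * (χ x * D' 0 x))
    + (∫ x in Ω, f x * (partialDeriv 0 χ x * D' 1 x))
    - ∫ x in Ω, f x * (partialDeriv 1 χ x * D' 0 x)

lemma partialDeriv_comm (hf : ContDiff ℝ ∞ f) (x : Plane) :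
    partialDeriv 0 (partialDeriv 1 f) x = partialDeriv 1 (partialDeriv 0 f) x := by
  have hsymm : IsSymmSndFDerivAt ℝ f x :=
    hf.contDiffAt.isSymmSndFDerivAt (by simpa using WithTop.coe_le_coe.2 (le_top : (2 : ℕ∞) ≤ ⊤))
  have hd : DifferentiableAt ℝ (fderiv ℝ f) x :=
    (hf.fderiv_right (m := ∞) (by simp)).differentiable (by simp) x
  have e : ∀ i j : Fin 2, partialDeriv i (partialDeriv j f) x =
      fderiv ℝ (fderiv ℝ f) x (EuclideanSpace.single i 1) (EuclideanSpace.single j 1) := by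
    intro i j
    have h := fderiv_clm_apply hd (differentiableAt_const (EuclideanSpace.single j (1 : ℝ)))
    have : partialDeriv i (partialDeriv j f) x =
      fderiv ℝ (fun y => fderiv ℝ f y (EuclideanSpace.single j 1)) x
        (EuclideanSpace.single i 1) := rfl
    rw [this, h]
    simp
  rw [e, e]
  exact hsymm.eq _ _

lemma integral_trace_mul_eq_zero (hg : ∀ᵐ x ∂(boundaryMeasure Ω), x ∈ U → g x = 0)
    (hs : tsupport ψ ⊆ U) : ∫ x, g x * ψ x ∂(boundaryMeasure Ω) = 0 := by
  refine integral_eq_zero_of_ae ?_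
  filter_upwards [hg] with x hx
  by_cases hxU : x ∈ U
  · simp [hx hxU]
  · simp [image_eq_zero_of_notMem_tsupport fun h => hxU (hs h)]

lemma integral_mul_swap {μ : Measure Plane} (a b c : Plane → ℂ) :
    ∫ x, a x * (b x * c x) ∂μ = ∫ x, c x * (b x * a x) ∂μ := by
  congr 1; funext x; ring

/-- For smooth `φ` in place of `f'`, `d(χ f) ∧ dφ = d(χ f dφ)`, and the boundary integral contains
the trace of `f`. Approximation is needed because the second derivatives of `φ`, which cancel by
symmetry, do not exist for `f'`. -/
lemma bracketForm_eq_zero_left (hΩ : IsPiecewiseFlat Ω V) (hU : IsFlatPatch Ω U ν)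
    (hf : HasTrace Ω f D g) (hf' : HasTrace Ω f' D' g')
    (hg : ∀ᵐ x ∂(boundaryMeasure Ω), x ∈ U → g x = 0) (hχ : ContDiff ℝ ∞ χ)
    (hc : HasCompactSupport χ) (hs : tsupport χ ⊆ U) : bracketForm Ω χ f D D' = 0 := by
  obtain ⟨φ, hφ, -, h2, -⟩ := hf'.exists_approx
  have mφ' := fun j k => hΩ.memLp_of_continuous (continuous_partialDeriv (hφ k) j)
  have mD := fun j => memLp_continuous_mul (hf.memLp_deriv j) hχ.continuous hc
  have mf := fun j => memLp_continuous_mul hf.memLp (continuous_partialDeriv hχ j)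
    (hasCompactSupport_partialDeriv hc j)
  have t1 := tendsto_integral_mul_of_eLpNorm (mφ' 1) (hf'.memLp_deriv 1) (mD 0) (h2 1)
  have t2 := tendsto_integral_mul_of_eLpNorm (mφ' 0) (hf'.memLp_deriv 0) (mD 1) (h2 0)
  have t3 := tendsto_integral_mul_of_eLpNorm (mφ' 1) (hf'.memLp_deriv 1) (mf 0) (h2 1)
  have t4 := tendsto_integral_mul_of_eLpNorm (mφ' 0) (hf'.memLp_deriv 0) (mf 1) (h2 0)
  have key := tendsto_nhds_unique (((t1.sub t2).add t3).sub t4)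
    (tendsto_const_nhds.congr (f₁ := fun _ => (0 : ℂ)) fun k => ?_)
  · rw [← key, bracketForm, integral_mul_swap (D 0), integral_mul_swap (D 1),
      integral_mul_swap f, integral_mul_swap f]
  · have hp := fun j => contDiff_partialDeriv (hφ k) j
    have g1 := hf.gaussGreen hΩ hU (hχ.mul (hp 1)) hc.mul_right
      (tsupport_mul_subset_left.trans hs) 0
    have g2 := hf.gaussGreen hΩ hU (hχ.mul (hp 0)) hc.mul_right
      (tsupport_mul_subset_left.trans hs) 1
    rw [integral_trace_mul_eq_zero hg (tsupport_mul_subset_left.trans hs), mul_zero] at g1 g2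
    have mm : MemLp (fun x => χ x * partialDeriv 0 (partialDeriv 1 (φ k)) x) 2
        (volume.restrict Ω) :=
      hΩ.memLp_of_continuous (hχ.continuous.mul (continuous_partialDeriv (hp 1) 0))
    have i0 := integrable_mul_two hf.memLp mm
    have e1 : ∫ x in Ω, f x * partialDeriv 0 (fun y => χ y * partialDeriv 1 (φ k) y) x =
        (∫ x in Ω, partialDeriv 1 (φ k) x * (partialDeriv 0 χ x * f x)) +
          ∫ x in Ω, f x * (χ x * partialDeriv 0 (partialDeriv 1 (φ k)) x) := by
      rw [← integral_add (integrable_mul_two (mφ' 1 k) (mf 0)) i0]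
      congr 1; funext x
      rw [partialDeriv_mul hχ (hp 1)]; ring
    have e2 : ∫ x in Ω, f x * partialDeriv 1 (fun y => χ y * partialDeriv 0 (φ k) y) x =
        (∫ x in Ω, partialDeriv 0 (φ k) x * (partialDeriv 1 χ x * f x)) +
          ∫ x in Ω, f x * (χ x * partialDeriv 0 (partialDeriv 1 (φ k)) x) := by
      rw [← integral_add (integrable_mul_two (mφ' 0 k) (mf 1)) i0]
      congr 1; funext x
      rw [partialDeriv_mul hχ (hp 0), partialDeriv_comm (hφ k)]; ring
    have e3 : ∀ i j : Fin 2, ∫ x in Ω, D i x * (χ x * partialDeriv j (φ k) x) =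
        ∫ x in Ω, partialDeriv j (φ k) x * (χ x * D i x) := fun i j => by
      congr 1; funext x; ring
    rw [e1, e3] at g1
    rw [e2, e3] at g2
    linear_combination g2 - g1

/-- Now `f` is approximated by smooth `φ`, and `d(χ φ) ∧ df' = -d(f' d(χ φ))` has a boundary
integral containing the trace of `f'`. -/
lemma bracketForm_eq_zero_right (hΩ : IsPiecewiseFlat Ω V) (hU : IsFlatPatch Ω U ν)
    (hf : HasTrace Ω f D g) (hf' : HasTrace Ω f' D' g')
    (hg : ∀ᵐ x ∂(boundaryMeasure Ω), x ∈ U → g' x = 0) (hχ : ContDiff ℝ ∞ χ)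
    (hc : HasCompactSupport χ) (hs : tsupport χ ⊆ U) : bracketForm Ω χ f D D' = 0 := by
  obtain ⟨φ, hφ, h1, h2, -⟩ := hf.exists_approx
  have mφ := fun k => hΩ.memLp_of_continuous (hφ k).continuous
  have mφ' := fun j k => hΩ.memLp_of_continuous (continuous_partialDeriv (hφ k) j)
  have mD := fun j => memLp_continuous_mul (hf'.memLp_deriv j) hχ.continuous hc
  have mD' := fun i j => memLp_continuous_mul (hf'.memLp_deriv j) (continuous_partialDeriv hχ i)
    (hasCompactSupport_partialDeriv hc i)
  have t1 := tendsto_integral_mul_of_eLpNorm (mφ' 0) (hf.memLp_deriv 0) (mD 1) (h2 0)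
  have t2 := tendsto_integral_mul_of_eLpNorm (mφ' 1) (hf.memLp_deriv 1) (mD 0) (h2 1)
  have t3 := tendsto_integral_mul_of_eLpNorm mφ hf.memLp (mD' 0 1) h1
  have t4 := tendsto_integral_mul_of_eLpNorm mφ hf.memLp (mD' 1 0) h1
  refine tendsto_nhds_unique (((t1.sub t2).add t3).sub t4)
    (tendsto_const_nhds.congr (f₁ := fun _ => (0 : ℂ)) fun k => ?_)
  have hp := hχ.mul (hφ k)
  have hpc : HasCompactSupport fun x => χ x * φ k x := hc.mul_right
  have hps : tsupport (fun x => χ x * φ k x) ⊆ U := tsupport_mul_subset_left.trans hs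
  have g1 := fun i j => hf'.gaussGreen hΩ hU (contDiff_partialDeriv hp i)
    (hasCompactSupport_partialDeriv hpc i) ((tsupport_partialDeriv_subset _ i).trans hps) j
  simp only [integral_trace_mul_eq_zero hg ((tsupport_partialDeriv_subset _ _).trans hps),
    mul_zero] at g1
  have e : ∀ i j, ∫ x in Ω, D' j x * partialDeriv i (fun y => χ y * φ k y) x =
      (∫ x in Ω, φ k x * (partialDeriv i χ x * D' j x)) +
        ∫ x in Ω, partialDeriv i (φ k) x * (χ x * D' j x) := fun i j => by
    rw [← integral_add (integrable_mul_two (mφ k) (mD' i j))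
      (integrable_mul_two (mφ' i k) (mD j))]
    congr 1; funext x
    rw [partialDeriv_mul hχ (hφ k)]; ring
  have a1 := g1 0 1
  have a2 := g1 1 0
  simp only [partialDeriv_comm hp] at a2
  rw [e] at a1 a2
  linear_combination a2 - a1

/-! ### Operations on functions with a trace -/

lemma TendstoL2.sub {μ : Measure Plane} {F F' : ℕ → Plane → ℂ}
    (h : TendstoL2 μ F f) (h' : TendstoL2 μ F' f')
    (hm : ∀ k, AEStronglyMeasurable (F k) μ) (hm' : ∀ k, AEStronglyMeasurable (F' k) μ)
    (hf : AEStronglyMeasurable f μ) (hf' : AEStronglyMeasurable f' μ) :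
    TendstoL2 μ (fun k x => F k x - F' k x) (fun x => f x - f' x) := by
  have h0 := h.add h'
  rw [add_zero] at h0
  refine tendsto_of_tendsto_of_tendsto_of_le_of_le tendsto_const_nhds h0
    (fun _ => zero_le) fun k => ?_
  have e : (fun x => F k x - F' k x - (f x - f' x)) =
      (fun x => F k x - f x) - fun x => F' k x - f' x := by
    funext x; simp only [Pi.sub_apply]; ring
  simp only [e]
  exact eLpNorm_sub_le ((hm k).sub hf) ((hm' k).sub hf') (by norm_num)

lemma partialDeriv_sub (hf : ContDiff ℝ ∞ f) (hg : ContDiff ℝ ∞ g) (j : Fin 2) (x : Plane) :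
    partialDeriv j (fun y => f y - g y) x = partialDeriv j f x - partialDeriv j g x := by
  simp only [partialDeriv]
  rw [fderiv_fun_sub (hf.differentiable (by simp) x) (hg.differentiable (by simp) x)]
  rfl

lemma HasTrace.sub (hf : HasTrace Ω f D g) (hf' : HasTrace Ω f' D' g') :
    HasTrace Ω (fun x => f x - f' x) (fun j x => D j x - D' j x) (fun x => g x - g' x) := by
  refine ⟨hf.memLp.sub hf'.memLp, fun j => (hf.memLp_deriv j).sub (hf'.memLp_deriv j),
    hf.memLp_trace.sub hf'.memLp_trace, ?_⟩
  obtain ⟨φ, hφ, h1, h2, h3⟩ := hf.exists_approx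
  obtain ⟨φ', hφ', h1', h2', h3'⟩ := hf'.exists_approx
  refine ⟨fun k x => φ k x - φ' k x, fun k => (hφ k).sub (hφ' k), h1.sub h1' ?_ ?_ hf.memLp.1
    hf'.memLp.1, fun j => ?_, h3.sub h3' ?_ ?_ hf.memLp_trace.1 hf'.memLp_trace.1⟩
  · exact fun k => (hφ k).continuous.aestronglyMeasurable
  · exact fun k => (hφ' k).continuous.aestronglyMeasurable
  · have := (h2 j).sub (h2' j)
      (fun k => (continuous_partialDeriv (hφ k) j).aestronglyMeasurable)
      (fun k => (continuous_partialDeriv (hφ' k) j).aestronglyMeasurable)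
      (hf.memLp_deriv j).1 (hf'.memLp_deriv j).1
    simpa only [← partialDeriv_sub (hφ _) (hφ' _)] using this
  · exact fun k => (hφ k).continuous.aestronglyMeasurable
  · exact fun k => (hφ' k).continuous.aestronglyMeasurable

lemma aestronglyMeasurable_fderiv_comp {μ : Measure Plane} {F : ℂ → ℂ} (hF : ContDiff ℝ ∞ F)
    (hf : AEStronglyMeasurable f μ) (hg : AEStronglyMeasurable g μ) :
    AEStronglyMeasurable (fun x => fderiv ℝ F (f x) (g x)) μ :=
  (isBoundedBilinearMap_apply (𝕜 := ℝ) (E := ℂ) (F := ℂ)).continuous.comp_aestronglyMeasurable₂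
    ((hF.continuous_fderiv (by simp)).comp_aestronglyMeasurable hf) hg

lemma memLp_fderiv_comp {μ : Measure Plane} {F : ℂ → ℂ} (hF : ContDiff ℝ ∞ F) {C : ℝ}
    (hC : ∀ z, ‖fderiv ℝ F z‖ ≤ C) (hf : AEStronglyMeasurable f μ) (hg : MemLp g 2 μ) :
    MemLp (fun x => fderiv ℝ F (f x) (g x)) 2 μ :=
  MemLp.of_le_mul hg (aestronglyMeasurable_fderiv_comp hF hf hg.1) (c := C)
    (Eventually.of_forall fun x => (fderiv ℝ F (f x)).le_of_opNorm_le (hC _) _)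

lemma lipschitzWith_of_norm_fderiv_le {F : ℂ → ℂ} (hF : ContDiff ℝ ∞ F) {C : ℝ}
    (hC : ∀ z, ‖fderiv ℝ F z‖ ≤ C) : LipschitzWith C.toNNReal F :=
  lipschitzWith_of_nnnorm_fderiv_le (𝕜 := ℝ) (hF.differentiable (by simp)) fun z => by
    rw [← NNReal.coe_le_coe, coe_nnnorm, Real.coe_toNNReal _ ((norm_nonneg _).trans (hC z))]
    exact hC z

lemma tendsto_eLpNorm_of_le {μ : Measure Plane} {A B : ℕ → Plane → ℂ} {C : ℝ}
    (hB : Tendsto (fun k => eLpNorm (B k) 2 μ) atTop (𝓝 0)) (h : ∀ k x, ‖A k x‖ ≤ C * ‖B k x‖) :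
    Tendsto (fun k => eLpNorm (A k) 2 μ) atTop (𝓝 0) := by
  have h0 := ENNReal.Tendsto.const_mul hB (Or.inr (ENNReal.ofReal_ne_top (r := C)))
  rw [mul_zero] at h0
  exact tendsto_of_tendsto_of_tendsto_of_le_of_le tendsto_const_nhds h0 (fun _ => zero_le)
    fun k => eLpNorm_le_mul_eLpNorm_of_ae_le_mul (Eventually.of_forall (h k)) 2

lemma TendstoL2.comp_lipschitz {μ : Measure Plane} {φ : ℕ → Plane → ℂ} (h : TendstoL2 μ φ f)
    {F : ℂ → ℂ} {K : NNReal} (hF : LipschitzWith K F) :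
    TendstoL2 μ (fun k x => F (φ k x)) (fun x => F (f x)) :=
  tendsto_eLpNorm_of_le (C := K) h fun k x => by
    simpa [dist_eq_norm] using hF.dist_le_mul (φ k x) (f x)

/-- The chain rule for a smooth function with bounded derivative. -/
lemma HasTrace.comp (hf : HasTrace Ω f D g) {F : ℂ → ℂ}
    (hF : ContDiff ℝ ∞ F) {C : ℝ} (hC : ∀ z, ‖fderiv ℝ F z‖ ≤ C) (hF0 : F 0 = 0) :
    HasTrace Ω (fun x => F (f x)) (fun j x => fderiv ℝ F (f x) (D j x)) (fun x => F (g x)) := by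
  have hlip := lipschitzWith_of_norm_fderiv_le hF hC
  refine ⟨hlip.comp_memLp hF0 hf.memLp,
    fun j => memLp_fderiv_comp hF hC hf.memLp.1 (hf.memLp_deriv j),
    hlip.comp_memLp hF0 hf.memLp_trace, ?_⟩
  obtain ⟨φ, hφ, h1, h2, h3⟩ := hf.exists_approx
  -- Convergence almost everywhere, available along a subsequence, is what makes the derivative of
  -- `F` at `φ` converge.
  have hmeas : TendstoInMeasure (volume.restrict Ω) φ atTop f :=
    tendstoInMeasure_of_tendsto_eLpNorm (p := 2) (by simp)
      (fun k => (hφ k).continuous.aestronglyMeasurable) hf.memLp.1 h1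
  obtain ⟨ns, hns, hae⟩ := hmeas.exists_seq_tendsto_ae
  have h1' : TendstoL2 (volume.restrict Ω) (fun k => φ (ns k)) f := h1.comp hns.tendsto_atTop
  have h2' : ∀ j, TendstoL2 (volume.restrict Ω) (fun k => partialDeriv j (φ (ns k))) (D j) :=
    fun j => (h2 j).comp hns.tendsto_atTop
  have h3' : TendstoL2 (boundaryMeasure Ω) (fun k => φ (ns k)) g := h3.comp hns.tendsto_atTop
  refine ⟨fun k x => F (φ (ns k) x), fun k => hF.comp (hφ _), h1'.comp_lipschitz hlip,
    fun j => ?_, h3'.comp_lipschitz hlip⟩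
  have hchain : ∀ k x, partialDeriv j (fun y => F (φ (ns k) y)) x =
      fderiv ℝ F (φ (ns k) x) (partialDeriv j (φ (ns k)) x) := fun k x => by
    have := fderiv_comp x (hF.differentiable (by simp) (φ (ns k) x))
      ((hφ (ns k)).differentiable (by simp) x)
    have e : partialDeriv j (fun y => F (φ (ns k) y)) x =
      fderiv ℝ (F ∘ φ (ns k)) x (EuclideanSpace.single j 1) := rfl
    rw [e, this]; rfl
  -- The error is `F'(φₖ)(∂φₖ - D) + (F'(φₖ) - F'(f)) D`: the first term is small since `F'` is
  -- bounded, the second by dominated convergence.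
  have t1 : Tendsto (fun k => eLpNorm (fun x => fderiv ℝ F (φ (ns k) x)
      (partialDeriv j (φ (ns k)) x - D j x)) 2 (volume.restrict Ω)) atTop (𝓝 0) :=
    tendsto_eLpNorm_of_le (C := C) (h2' j) fun k x =>
      (fderiv ℝ F (φ (ns k) x)).le_of_opNorm_le (hC _) _
  have mk := fun k => aestronglyMeasurable_fderiv_comp hF
    ((hφ (ns k)).continuous.aestronglyMeasurable) (hf.memLp_deriv j).1
  have t2 := tendsto_eLpNorm_two_of_dominated
    (F := fun k x => fderiv ℝ F (φ (ns k) x) (D j x)) (f := fun x => fderiv ℝ F (f x) (D j x))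
    (G := fun x => C * ‖D j x‖) mk
    (aestronglyMeasurable_fderiv_comp hF hf.memLp.1 (hf.memLp_deriv j).1)
    ((hf.memLp_deriv j).norm.const_mul C)
    (fun k => Eventually.of_forall fun x => (fderiv ℝ F (φ (ns k) x)).le_of_opNorm_le (hC _) _)
    (by
      filter_upwards [hae] with x hx
      exact (((hF.continuous_fderiv (by simp)).clm_apply continuous_const).tendsto (f x)).comp hx)
  have t := t1.add t2
  rw [add_zero] at t
  refine tendsto_of_tendsto_of_tendsto_of_le_of_le tendsto_const_nhds t
    (fun _ => zero_le) fun k => ?_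
  have e : (fun x => partialDeriv j (fun y => F (φ (ns k) y)) x - fderiv ℝ F (f x) (D j x)) =
      (fun x => fderiv ℝ F (φ (ns k) x) (partialDeriv j (φ (ns k)) x - D j x)) +
        fun x => fderiv ℝ F (φ (ns k) x) (D j x) - fderiv ℝ F (f x) (D j x) := by
    funext x
    simp only [Pi.add_apply, hchain, map_sub]
    ring
  simp only [e]
  refine eLpNorm_add_le ?_ ?_ (by norm_num)
  · exact aestronglyMeasurable_fderiv_comp hF ((hφ (ns k)).continuous.aestronglyMeasurable)
      ((continuous_partialDeriv (hφ (ns k)) j).aestronglyMeasurable.sub (hf.memLp_deriv j).1)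
  · exact (mk k).sub (aestronglyMeasurable_fderiv_comp hF hf.memLp.1 (hf.memLp_deriv j).1)

lemma HasTrace.clm (hf : HasTrace Ω f D g) (A : ℂ →L[ℝ] ℂ) :
    HasTrace Ω (fun x => A (f x)) (fun j x => A (D j x)) (fun x => A (g x)) := by
  have h := hf.comp (F := A) A.contDiff (C := ‖A‖) (fun z => by simp) (map_zero A)
  simpa using h

lemma HasTrace.const_mul (hf : HasTrace Ω f D g) (c : ℂ) :
    HasTrace Ω (fun x => c * f x) (fun j x => c * D j x) (fun x => c * g x) :=
  hf.clm (ContinuousLinearMap.mul ℝ ℂ c)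

lemma HasTrace.conj (hf : HasTrace Ω f D g) :
    HasTrace Ω (fun x => starRingEnd ℂ (f x)) (fun j x => starRingEnd ℂ (D j x))
      (fun x => starRingEnd ℂ (g x)) :=
  hf.clm (Complex.conjCLE : ℂ →L[ℝ] ℂ)

/-! ### Boundary statements patch by patch and uniqueness of the trace. -/

/-- A property that holds almost everywhere in each flat patch holds almost everywhere. -/
lemma IsPiecewiseFlat.ae_boundary_of_patch (hΩ : IsPiecewiseFlat Ω V) {p : Plane → Prop}
    (h : ∀ U ν, IsFlatPatch Ω U ν → ∀ᵐ x ∂(boundaryMeasure Ω), x ∈ U → p x) :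
    ∀ᵐ x ∂(boundaryMeasure Ω), p x := by
  have := boundaryMeasure_noAtoms Ω
  have hV : ∀ᵐ x ∂(boundaryMeasure Ω), x ∉ V := by
    simpa [ae_iff] using hΩ.finite.measure_zero (boundaryMeasure Ω)
  have h0 : boundaryMeasure Ω ({x | ¬ p x} \ V) = 0 := by
    refine measure_null_of_locally_null _ fun x hx => ?_
    obtain ⟨U, ν, hxU, hU⟩ := hΩ.exists_isFlatPatch hx.2
    refine ⟨({x | ¬ p x} \ V) ∩ U, inter_mem_nhdsWithin _ (hU.isOpen.mem_nhds hxU), ?_⟩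
    · refine measure_mono_null (fun y hy => ?_) (ae_iff.1 (h U ν hU))
      exact fun hp => hy.1.1 (hp hy.2)
  filter_upwards [hV, measure_eq_zero_iff_ae_notMem.1 h0] with x h1 h2
  by_contra h3
  exact h2 ⟨h3, h1⟩

lemma ae_mem_frontier (Ω : Set Plane) : ∀ᵐ x ∂(boundaryMeasure Ω), x ∈ frontier Ω :=
  ae_restrict_mem isClosed_frontier.measurableSet

/-- The boundary trace is unique. -/
lemma HasTrace.ae_eq (hΩ : IsPiecewiseFlat Ω V) (hf : HasTrace Ω f D g)
    (hf' : HasTrace Ω f D g') : g =ᵐ[boundaryMeasure Ω] g' := by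
  refine hΩ.ae_boundary_of_patch fun U ν hU => ?_
  have := hΩ.isFiniteMeasure_boundary
  have h := hf.sub hf'
  simp only [sub_self] at h
  by_cases hne : (frontier Ω ∩ U).Nonempty
  · obtain ⟨y, hy, hyU⟩ := hne
    have hν := (hU.normal y hy hyU).1
    -- The difference is the zero function with zero gradient and trace `g - g'`. Gauss-Green thus
    -- says that `ν j` times the integral of `g - g'` against any test function is zero, which is
    -- informative only for a nonzero component of `ν`.
    obtain ⟨j, hj⟩ : ∃ j, ν j ≠ 0 := by
      by_contra! h0
      have : ν = 0 := by ext i; exact h0 i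
      simp [this] at hν
    have key := hU.isOpen.ae_eq_zero_of_integral_contDiff_smul_eq_zero
      (f := fun x => g x - g' x) (μ := boundaryMeasure Ω)
      ((h.memLp_trace.integrable (by norm_num)).locallyIntegrable.locallyIntegrableOn U)
      (fun ρ hρ hc hs => by
        have hsub : tsupport (fun x => (ρ x : ℂ)) ⊆ tsupport ρ :=
          closure_mono fun x hx => by simpa using hx
        have := h.gaussGreen hΩ hU (ψ := fun x => (ρ x : ℂ))
          (Complex.ofRealCLM.contDiff.comp hρ)
          (hc.comp_left (g := ((↑) : ℝ → ℂ)) Complex.ofReal_zero) (hsub.trans hs) j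
        simp only [zero_mul, integral_zero, add_zero] at this
        have := (mul_eq_zero.1 this.symm).resolve_left (Complex.ofReal_ne_zero.2 hj)
        rw [← this]
        congr 1; funext x
        rw [Complex.real_smul, mul_comm])
    filter_upwards [key] with x hx hxU using sub_eq_zero.1 (hx hxU)
  · filter_upwards [ae_mem_frontier Ω] with x hx hxU
    exact absurd ⟨x, hx, hxU⟩ hne

/-! ### Truncation -/

/-- A smooth compactly supported function that is the identity near the origin and commutes with
rotations. -/
def trunc (z : ℂ) : ℂ := (Real.smoothTransition (2 - ‖z‖ ^ 2) : ℝ) * z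

/-- The truncation at height of order `n + 1`. -/
def truncAt (n : ℕ) (z : ℂ) : ℂ := ((n : ℝ) + 1) • trunc (((n : ℝ) + 1)⁻¹ • z)

lemma contDiff_trunc : ContDiff ℝ ∞ trunc := by
  refine ContDiff.mul ?_ contDiff_id
  refine Complex.ofRealCLM.contDiff.comp (Real.smoothTransition.contDiff.comp ?_)
  exact contDiff_const.sub (contDiff_norm_sq ℝ)

lemma trunc_eq_self {z : ℂ} (hz : ‖z‖ < 1) : trunc z = z := by
  rw [trunc, Real.smoothTransition.one_of_one_le (by nlinarith [norm_nonneg z])]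
  simp

lemma hasCompactSupport_trunc : HasCompactSupport trunc := by
  refine HasCompactSupport.intro (isCompact_closedBall (0 : ℂ) 2) fun z hz => ?_
  rw [mem_closedBall_zero_iff, not_le] at hz
  rw [trunc, Real.smoothTransition.zero_of_nonpos (by nlinarith)]
  simp

lemma norm_trunc_le (z : ℂ) : ‖trunc z‖ ≤ ‖z‖ := by
  rw [trunc, norm_mul, Complex.norm_real, Real.norm_eq_abs,
    abs_of_nonneg (Real.smoothTransition.nonneg _)]
  exact mul_le_of_le_one_left (norm_nonneg _) (Real.smoothTransition.le_one _)

lemma trunc_mul {c : ℂ} (hc : ‖c‖ = 1) (z : ℂ) : trunc (c * z) = c * trunc z := by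
  simp only [trunc, norm_mul, hc, one_mul]; ring

lemma contDiff_truncAt (n : ℕ) : ContDiff ℝ ∞ (truncAt n) := by
  have h : ContDiff ℝ ∞ fun z : ℂ => ((n : ℝ) + 1)⁻¹ • z := contDiff_id.const_smul _
  exact (contDiff_trunc.comp h).const_smul ((n : ℝ) + 1)

/-- The two scaling factors cancel in the derivative, so the Lipschitz constants of all truncations
share one bound. -/
lemma fderiv_truncAt (n : ℕ) (z : ℂ) :
    fderiv ℝ (truncAt n) z = fderiv ℝ trunc (((n : ℝ) + 1)⁻¹ • z) := by
  have h1 : HasFDerivAt (fun z : ℂ => ((n : ℝ) + 1)⁻¹ • z)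
      (((n : ℝ) + 1)⁻¹ • ContinuousLinearMap.id ℝ ℂ) z :=
    (hasFDerivAt_id (𝕜 := ℝ) z).fun_const_smul (((n : ℝ) + 1)⁻¹)
  have h2 := ((contDiff_trunc.differentiable (by simp) (((n : ℝ) + 1)⁻¹ • z)).hasFDerivAt.comp
    z h1).fun_const_smul ((n : ℝ) + 1)
  have h3 : fderiv ℝ (truncAt n) z = _ := h2.fderiv
  have hn : ((n : ℝ) + 1) ≠ 0 := by positivity
  rw [h3]
  ext w
  simp only [smul_apply, ContinuousLinearMap.comp_apply,
    ContinuousLinearMap.id_apply, map_smul, smul_smul, mul_inv_cancel₀ hn, one_smul]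

lemma exists_norm_fderiv_truncAt_le : ∃ C, ∀ n z, ‖fderiv ℝ (truncAt n) z‖ ≤ C := by
  obtain ⟨C, hC⟩ := (hasCompactSupport_trunc.fderiv (𝕜 := ℝ)).exists_bound_of_continuous
    (contDiff_trunc.continuous_fderiv (by simp))
  exact ⟨C, fun n z => by rw [fderiv_truncAt]; exact hC _⟩

lemma exists_norm_truncAt_le (n : ℕ) : ∃ C, ∀ z, ‖truncAt n z‖ ≤ C := by
  obtain ⟨C, hC⟩ := hasCompactSupport_trunc.exists_bound_of_continuous contDiff_trunc.continuous
  refine ⟨((n : ℝ) + 1) * C, fun z => ?_⟩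
  rw [truncAt, norm_smul, Real.norm_eq_abs, abs_of_pos (by positivity)]
  exact mul_le_mul_of_nonneg_left (hC _) (by positivity)

lemma norm_truncAt_le (n : ℕ) (z : ℂ) : ‖truncAt n z‖ ≤ ‖z‖ := by
  have hn : (0 : ℝ) < (n : ℝ) + 1 := by positivity
  rw [truncAt, norm_smul, Real.norm_eq_abs, abs_of_pos hn]
  refine (mul_le_mul_of_nonneg_left (norm_trunc_le _) hn.le).trans (le_of_eq ?_)
  rw [norm_smul, Real.norm_eq_abs, abs_of_pos (inv_pos.2 hn), mul_inv_cancel_left₀ hn.ne']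

lemma truncAt_zero (n : ℕ) : truncAt n 0 = 0 := by simp [truncAt, trunc]

lemma truncAt_mul {c : ℂ} (hc : ‖c‖ = 1) (n : ℕ) (z : ℂ) :
    truncAt n (c * z) = c * truncAt n z := by
  rw [truncAt, truncAt, ← mul_smul_comm, trunc_mul hc, mul_smul_comm]

/-- Differentiating the rotation invariance shows that truncated gradients rotate along with the
function. -/
lemma fderiv_truncAt_mul {c : ℂ} (hc : ‖c‖ = 1) (n : ℕ) (z w : ℂ) :
    fderiv ℝ (truncAt n) (c * z) (c * w) = c * fderiv ℝ (truncAt n) z w := by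
  have hd := (contDiff_truncAt n).differentiable (by simp)
  have hm : HasFDerivAt (fun z : ℂ => c * z) (ContinuousLinearMap.mul ℝ ℂ c) z :=
    (ContinuousLinearMap.mul ℝ ℂ c).hasFDerivAt
  have h1 := (hd (c * z)).hasFDerivAt.comp z hm
  have h2 := (ContinuousLinearMap.mul ℝ ℂ c).hasFDerivAt.comp z (hd z).hasFDerivAt
  have e : truncAt n ∘ (fun z : ℂ => c * z) = (ContinuousLinearMap.mul ℝ ℂ c) ∘ truncAt n := by
    funext z; exact truncAt_mul hc n z
  rw [e] at h1
  exact congrArg (fun A : ℂ →L[ℝ] ℂ => A w) (h1.unique h2)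

lemma eventually_norm_smul_lt_one (z : ℂ) : ∀ᶠ n : ℕ in atTop, ‖((n : ℝ) + 1)⁻¹ • z‖ < 1 := by
  have h : Tendsto (fun n : ℕ => ((n : ℝ) + 1)⁻¹ • z) atTop (𝓝 ((0 : ℝ) • z)) := by
    have := (tendsto_one_div_add_atTop_nhds_zero_nat (𝕜 := ℝ)).smul_const z
    simpa only [one_div] using this
  rw [zero_smul] at h
  simpa using h.norm.eventually (gt_mem_nhds (by simp : ‖(0 : ℂ)‖ < 1))

lemma tendsto_truncAt (z : ℂ) : Tendsto (fun n => truncAt n z) atTop (𝓝 z) := by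
  refine tendsto_const_nhds.congr' ?_
  filter_upwards [eventually_norm_smul_lt_one z] with n hn
  have hn0 : ((n : ℝ) + 1) ≠ 0 := by positivity
  rw [truncAt, trunc_eq_self hn, smul_smul, mul_inv_cancel₀ hn0, one_smul]

lemma tendsto_fderiv_truncAt (z w : ℂ) :
    Tendsto (fun n => fderiv ℝ (truncAt n) z w) atTop (𝓝 w) := by
  refine tendsto_const_nhds.congr' ?_
  filter_upwards [eventually_norm_smul_lt_one z] with n hn
  have : trunc =ᶠ[𝓝 (((n : ℝ) + 1)⁻¹ • z)] id := by
    filter_upwards [(isOpen_lt continuous_norm continuous_const).mem_nhds hn] with y hy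
    exact trunc_eq_self hy
  rw [fderiv_truncAt, this.fderiv_eq, fderiv_id]
  rfl

lemma HasTrace.truncAt (hf : HasTrace Ω f D g) (n : ℕ) :
    HasTrace Ω (fun x => PolygonDirac.truncAt n (f x))
      (fun j x => fderiv ℝ (PolygonDirac.truncAt n) (f x) (D j x)) (fun x => PolygonDirac.truncAt n (g x)) := by
  obtain ⟨C, hC⟩ := exists_norm_fderiv_truncAt_le
  exact hf.comp (contDiff_truncAt n) (hC n) (truncAt_zero n)

lemma tendstoL2_truncAt {μ : Measure Plane} (hf : MemLp f 2 μ) :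
    TendstoL2 μ (fun n x => truncAt n (f x)) f :=
  tendsto_eLpNorm_two_of_dominated (G := fun x => ‖f x‖)
    (fun n => (contDiff_truncAt n).continuous.comp_aestronglyMeasurable hf.1) hf.1 hf.norm
    (fun n => Eventually.of_forall fun _ => norm_truncAt_le n _)
    (Eventually.of_forall fun _ => tendsto_truncAt _)

lemma tendstoL2_fderiv_truncAt {μ : Measure Plane} (hf : AEStronglyMeasurable f μ)
    (hg : MemLp g 2 μ) :
    TendstoL2 μ (fun n x => fderiv ℝ (truncAt n) (f x) (g x)) g := by
  obtain ⟨C, hC⟩ := exists_norm_fderiv_truncAt_le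
  exact tendsto_eLpNorm_two_of_dominated (G := fun x => C * ‖g x‖)
    (fun n => aestronglyMeasurable_fderiv_comp (contDiff_truncAt n) hf hg.1) hg.1
    (hg.norm.const_mul C)
    (fun n => Eventually.of_forall fun x => (fderiv ℝ (truncAt n) (f x)).le_of_opNorm_le (hC n _) _)
    (Eventually.of_forall fun _ => tendsto_fderiv_truncAt _ _)

variable {Ω V U : Set Plane} {ν : Plane} {χ f f' f₁ f₂ g₁ g₂ : Plane → ℂ}
  {D D' E D₁ D₂ : Fin 2 → Plane → ℂ}

/-! ### The two integral identities -/

lemma memLp_star {μ : Measure Plane} {f : Plane → ℂ} (hf : MemLp f 2 μ) :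
    MemLp (fun x => starRingEnd ℂ (f x)) 2 μ :=
  (Complex.conjCLE : ℂ →L[ℝ] ℂ).comp_memLp' hf

lemma integrable_fun_sub {μ : Measure Plane} {f g : Plane → ℂ} (hf : Integrable f μ)
    (hg : Integrable g μ) : Integrable (fun x => f x - g x) μ :=
  hf.sub hg

lemma bracketForm_sub_left (hχ : ContDiff ℝ ∞ χ) (hc : HasCompactSupport χ)
    (hf : MemLp f 2 (volume.restrict Ω)) (hf' : MemLp f' 2 (volume.restrict Ω))
    (hD : ∀ j, MemLp (D j) 2 (volume.restrict Ω)) (hD' : ∀ j, MemLp (D' j) 2 (volume.restrict Ω))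
    (hE : ∀ j, MemLp (E j) 2 (volume.restrict Ω)) :
    bracketForm Ω χ (fun x => f x - f' x) (fun j x => D j x - D' j x) E =
      bracketForm Ω χ f D E - bracketForm Ω χ f' D' E := by
  have m := fun j => memLp_continuous_mul (hE j) hχ.continuous hc
  have m' := fun i j => memLp_continuous_mul (hE j) (continuous_partialDeriv hχ i)
    (hasCompactSupport_partialDeriv hc i)
  simp only [bracketForm, sub_mul]
  rw [integral_sub (integrable_mul_two (hD 0) (m 1)) (integrable_mul_two (hD' 0) (m 1)),
    integral_sub (integrable_mul_two (hD 1) (m 0)) (integrable_mul_two (hD' 1) (m 0)),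
    integral_sub (integrable_mul_two hf (m' 0 1)) (integrable_mul_two hf' (m' 0 1)),
    integral_sub (integrable_mul_two hf (m' 1 0)) (integrable_mul_two hf' (m' 1 0))]
  ring

lemma bracketForm_sub_right (hχ : ContDiff ℝ ∞ χ) (hc : HasCompactSupport χ)
    (hf : MemLp f 2 (volume.restrict Ω))
    (hD : ∀ j, MemLp (D j) 2 (volume.restrict Ω)) (hD' : ∀ j, MemLp (D' j) 2 (volume.restrict Ω))
    (hE : ∀ j, MemLp (E j) 2 (volume.restrict Ω)) :
    bracketForm Ω χ f D (fun j x => D' j x - E j x) =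
      bracketForm Ω χ f D D' - bracketForm Ω χ f D E := by
  have m := fun j => memLp_continuous_mul (hE j) hχ.continuous hc
  have m' := fun i j => memLp_continuous_mul (hE j) (continuous_partialDeriv hχ i)
    (hasCompactSupport_partialDeriv hc i)
  have k := fun j => memLp_continuous_mul (hD' j) hχ.continuous hc
  have k' := fun i j => memLp_continuous_mul (hD' j) (continuous_partialDeriv hχ i)
    (hasCompactSupport_partialDeriv hc i)
  simp only [bracketForm, mul_sub]
  rw [integral_sub (integrable_mul_two (hD 0) (k 1)) (integrable_mul_two (hD 0) (m 1)),
    integral_sub (integrable_mul_two (hD 1) (k 0)) (integrable_mul_two (hD 1) (m 0)),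
    integral_sub (integrable_mul_two hf (k' 0 1)) (integrable_mul_two hf (m' 0 1)),
    integral_sub (integrable_mul_two hf (k' 1 0)) (integrable_mul_two hf (m' 1 0))]
  ring

/-- The truncated area form does not change under a rotation of the boundary values. -/
lemma bracketForm_truncAt_eq (hΩ : IsPiecewiseFlat Ω V) (hU : IsFlatPatch Ω U ν)
    (h₁ : HasTrace Ω f₁ D₁ g₁) (h₂ : HasTrace Ω f₂ D₂ g₂) {c : ℂ} (hc1 : ‖c‖ = 1)
    (hg : ∀ᵐ x ∂(boundaryMeasure Ω), x ∈ U → g₂ x = c * g₁ x) (n : ℕ)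
    (hχ : ContDiff ℝ ∞ χ) (hc : HasCompactSupport χ) (hs : tsupport χ ⊆ U) :
    bracketForm Ω χ (fun x => truncAt n (f₁ x)) (fun j x => fderiv ℝ (truncAt n) (f₁ x) (D₁ j x))
        (fun j x => starRingEnd ℂ (D₁ j x)) =
      bracketForm Ω χ (fun x => truncAt n (f₂ x)) (fun j x => fderiv ℝ (truncAt n) (f₂ x) (D₂ j x))
        (fun j x => starRingEnd ℂ (D₂ j x)) := by
  have ha := h₁.const_mul c
  have hTa := ha.truncAt n
  have hT₂ := h₂.truncAt n
  -- Inside `U` the functions `c f₁` and `f₂` have the same trace. One is exchanged for the other in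
  -- one slot of the form at a time, first on the left, then on the right; finally `c` cancels
  -- against its conjugate.
  have l := bracketForm_eq_zero_left hΩ hU (hTa.sub hT₂) ha.conj (by
    filter_upwards [hg] with x hx hxU
    rw [hx hxU, sub_self]) hχ hc hs
  have r := bracketForm_eq_zero_right hΩ hU hT₂ (ha.conj.sub h₂.conj) (by
    filter_upwards [hg] with x hx hxU
    rw [hx hxU, sub_self]) hχ hc hs
  rw [bracketForm_sub_left hχ hc hTa.memLp hT₂.memLp hTa.memLp_deriv hT₂.memLp_deriv
    ha.conj.memLp_deriv, sub_eq_zero] at l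
  rw [bracketForm_sub_right hχ hc hT₂.memLp hT₂.memLp_deriv ha.conj.memLp_deriv
    h₂.conj.memLp_deriv, sub_eq_zero] at r
  rw [← r, ← l]
  have hcc : c * starRingEnd ℂ c = 1 := by
    rw [Complex.mul_conj, Complex.normSq_eq_norm_sq, hc1]; simp
  have e : ∀ a b d : ℂ, c * a * (b * (starRingEnd ℂ c * d)) = a * (b * d) := fun a b d => by
    linear_combination a * b * d * hcc
  simp only [bracketForm, truncAt_mul hc1, fderiv_truncAt_mul hc1, map_mul, e]

/-- A product of a `W^{1,2}` function and an `L²` function need not be square integrable. Truncating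
the first factor secures the hypothesis under which vertices are removable. -/
lemma memLp_truncAt_mul {μ : Measure Plane} {f h : Plane → ℂ} (hf : AEStronglyMeasurable f μ)
    (hh : MemLp h 2 μ) (n : ℕ) : MemLp (fun x => truncAt n (f x) * h x) 2 μ := by
  obtain ⟨C, hC⟩ := exists_norm_truncAt_le n
  refine MemLp.of_le_mul hh
    (((contDiff_truncAt n).continuous.comp_aestronglyMeasurable hf).mul hh.1) (c := C)
    (Eventually.of_forall fun x => ?_)
  rw [norm_mul]
  exact mul_le_mul_of_nonneg_right (hC _) (norm_nonneg _)

/-- The bracket form is the distribution attached to the area form. -/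
lemma bracketForm_eq_localForm_sub {f₁ f₂ : Plane → ℂ} {D₁ D₂ E₁ E₂ : Fin 2 → Plane → ℂ}
    (hχ : ContDiff ℝ ∞ χ) (hc : HasCompactSupport χ)
    (hf₁ : MemLp f₁ 2 (volume.restrict Ω)) (hf₂ : MemLp f₂ 2 (volume.restrict Ω))
    (hD₁ : ∀ j, MemLp (D₁ j) 2 (volume.restrict Ω)) (hD₂ : ∀ j, MemLp (D₂ j) 2 (volume.restrict Ω))
    (hE₁ : ∀ j, MemLp (E₁ j) 2 (volume.restrict Ω))
    (hE₂ : ∀ j, MemLp (E₂ j) 2 (volume.restrict Ω)) :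
    localForm Ω (fun x => (D₁ 0 x * E₁ 1 x - D₁ 1 x * E₁ 0 x) - (D₂ 0 x * E₂ 1 x - D₂ 1 x * E₂ 0 x))
      ![fun x => f₁ x * E₁ 1 x - f₂ x * E₂ 1 x, fun x => f₂ x * E₂ 0 x - f₁ x * E₁ 0 x] 0 χ =
      bracketForm Ω χ f₁ D₁ E₁ - bracketForm Ω χ f₂ D₂ E₂ := by
  have m₁ := fun j => memLp_continuous_mul (hE₁ j) hχ.continuous hc
  have m₁' := fun i j => memLp_continuous_mul (hE₁ j) (continuous_partialDeriv hχ i)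
    (hasCompactSupport_partialDeriv hc i)
  have m₂ := fun j => memLp_continuous_mul (hE₂ j) hχ.continuous hc
  have m₂' := fun i j => memLp_continuous_mul (hE₂ j) (continuous_partialDeriv hχ i)
    (hasCompactSupport_partialDeriv hc i)
  have i₁ := fun i j => integrable_mul_two (hD₁ i) (m₁ j)
  have i₂ := fun i j => integrable_mul_two (hD₂ i) (m₂ j)
  have k₁ := fun i j => integrable_mul_two hf₁ (m₁' i j)
  have k₂ := fun i j => integrable_mul_two hf₂ (m₂' i j)
  have e0 : ∫ x in Ω, χ x *
      ((D₁ 0 x * E₁ 1 x - D₁ 1 x * E₁ 0 x) - (D₂ 0 x * E₂ 1 x - D₂ 1 x * E₂ 0 x)) =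
      ((∫ x in Ω, D₁ 0 x * (χ x * E₁ 1 x)) - ∫ x in Ω, D₁ 1 x * (χ x * E₁ 0 x)) -
      ((∫ x in Ω, D₂ 0 x * (χ x * E₂ 1 x)) - ∫ x in Ω, D₂ 1 x * (χ x * E₂ 0 x)) := by
    rw [← integral_sub (i₁ 0 1) (i₁ 1 0), ← integral_sub (i₂ 0 1) (i₂ 1 0),
      ← integral_sub (integrable_fun_sub (i₁ 0 1) (i₁ 1 0)) (integrable_fun_sub (i₂ 0 1) (i₂ 1 0))]
    congr 1; funext x; ring
  have e1 : ∫ x in Ω, partialDeriv 0 χ x * (f₁ x * E₁ 1 x - f₂ x * E₂ 1 x) =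
      (∫ x in Ω, f₁ x * (partialDeriv 0 χ x * E₁ 1 x)) -
        ∫ x in Ω, f₂ x * (partialDeriv 0 χ x * E₂ 1 x) := by
    rw [← integral_sub (k₁ 0 1) (k₂ 0 1)]
    congr 1; funext x; ring
  have e2 : ∫ x in Ω, partialDeriv 1 χ x * (f₂ x * E₂ 0 x - f₁ x * E₁ 0 x) =
      (∫ x in Ω, f₂ x * (partialDeriv 1 χ x * E₂ 0 x)) -
        ∫ x in Ω, f₁ x * (partialDeriv 1 χ x * E₁ 0 x) := by
    rw [← integral_sub (k₂ 1 0) (k₁ 1 0)]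
    congr 1; funext x; ring
  simp only [localForm, Fin.sum_univ_two, Matrix.cons_val_zero, Matrix.cons_val_one, e0, e1, e2,
    bracketForm, Pi.zero_apply, mul_zero, integral_zero]
  ring

/-- The boundary values of `f₂` arise from those of `f₁` by the infinite-mass condition. -/
def InfiniteMassPair (Ω : Set Plane) (g₁ g₂ : Plane → ℂ) : Prop :=
  ∀ᵐ x ∂(boundaryMeasure Ω), ∀ ν : Plane, IsOutwardUnitNormal Ω x ν →
    g₂ x = Complex.I * ((ν 0 : ℂ) + Complex.I * (ν 1 : ℂ)) * g₁ x

lemma norm_infiniteMassFactor {ν : Plane} (hν : ‖ν‖ = 1) :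
    ‖Complex.I * ((ν 0 : ℂ) + Complex.I * (ν 1 : ℂ))‖ = 1 := by
  have h := norm_sq_eq_coord ν
  rw [hν] at h
  rw [norm_mul, Complex.norm_I, one_mul, mul_comm Complex.I, Complex.norm_add_mul_I, ← h]
  simp

/-- The normal is constant on a flat patch, hence so is the boundary factor. If the patch misses the
boundary, any unimodular constant will do. -/
lemma InfiniteMassPair.exists_factor (hb : InfiniteMassPair Ω g₁ g₂) (hU : IsFlatPatch Ω U ν) :
    ∃ c : ℂ, ‖c‖ = 1 ∧ ∀ᵐ x ∂(boundaryMeasure Ω), x ∈ U → g₂ x = c * g₁ x := by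
  by_cases hne : (frontier Ω ∩ U).Nonempty
  · obtain ⟨y, hy, hyU⟩ := hne
    refine ⟨_, norm_infiniteMassFactor (hU.normal y hy hyU).1, ?_⟩
    filter_upwards [hb, ae_mem_frontier Ω] with x hx hxf hxU
    exact hx ν (hU.normal x hxf hxU)
  · refine ⟨1, norm_one, ?_⟩
    filter_upwards [ae_mem_frontier Ω] with x hx hxU
    exact absurd ⟨x, hx, hxU⟩ hne

/-- The local identity has no boundary term (`b = 0`). Truncation acts on one factor only; the
conjugated gradients are left as they are. -/
lemma integral_truncated_area_eq (hΩ : IsPiecewiseFlat Ω V)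
    (h₁ : HasTrace Ω f₁ D₁ g₁) (h₂ : HasTrace Ω f₂ D₂ g₂) (hb : InfiniteMassPair Ω g₁ g₂) (n : ℕ) :
    ∫ x in Ω, ((fderiv ℝ (truncAt n) (f₁ x) (D₁ 0 x) * starRingEnd ℂ (D₁ 1 x)
        - fderiv ℝ (truncAt n) (f₁ x) (D₁ 1 x) * starRingEnd ℂ (D₁ 0 x))
      - (fderiv ℝ (truncAt n) (f₂ x) (D₂ 0 x) * starRingEnd ℂ (D₂ 1 x)
        - fderiv ℝ (truncAt n) (f₂ x) (D₂ 1 x) * starRingEnd ℂ (D₂ 0 x))) = 0 := by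
  have t₁ := h₁.truncAt n
  have t₂ := h₂.truncAt n
  have s₁ := h₁.conj.memLp_deriv
  have s₂ := h₂.conj.memLp_deriv
  have i₁ := fun i j => integrable_mul_two (t₁.memLp_deriv i) (s₁ j)
  have i₂ := fun i j => integrable_mul_two (t₂.memLp_deriv i) (s₂ j)
  have k₁ := fun j => memLp_truncAt_mul h₁.memLp.1 (s₁ j) n
  have k₂ := fun j => memLp_truncAt_mul h₂.memLp.1 (s₂ j) n
  have key := hΩ.integral_eq_of_local (b := 0)
    (h := ![fun x => truncAt n (f₁ x) * starRingEnd ℂ (D₁ 1 x)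
        - truncAt n (f₂ x) * starRingEnd ℂ (D₂ 1 x),
      fun x => truncAt n (f₂ x) * starRingEnd ℂ (D₂ 0 x)
        - truncAt n (f₁ x) * starRingEnd ℂ (D₁ 0 x)])
    (integrable_fun_sub (integrable_fun_sub (i₁ 0 1) (i₁ 1 0))
      (integrable_fun_sub (i₂ 0 1) (i₂ 1 0)))
    (fun j => by
      fin_cases j
      · exact (k₁ 1).sub (k₂ 1)
      · exact (k₂ 0).sub (k₁ 0))
    (integrable_zero _ _ _) (fun U ν hU χ hχ hc hs => by
      obtain ⟨c, hc1, hg⟩ := hb.exists_factor hU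
      have e := bracketForm_eq_localForm_sub hχ hc t₁.memLp t₂.memLp t₁.memLp_deriv
        t₂.memLp_deriv s₁ s₂
      rw [bracketForm_truncAt_eq hΩ hU h₁ h₂ hc1 hg n hχ hc hs, sub_self] at e
      exact e)
  simpa using key

/-- The area integrals of the two components agree. -/
lemma integral_area_eq (hΩ : IsPiecewiseFlat Ω V)
    (h₁ : HasTrace Ω f₁ D₁ g₁) (h₂ : HasTrace Ω f₂ D₂ g₂) (hb : InfiniteMassPair Ω g₁ g₂) :
    ∫ x in Ω, ((D₁ 0 x * starRingEnd ℂ (D₁ 1 x) - D₁ 1 x * starRingEnd ℂ (D₁ 0 x))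
      - (D₂ 0 x * starRingEnd ℂ (D₂ 1 x) - D₂ 1 x * starRingEnd ℂ (D₂ 0 x))) = 0 := by
  have s₁ := h₁.conj.memLp_deriv
  have s₂ := h₂.conj.memLp_deriv
  have split : ∀ A B : Fin 2 → Plane → ℂ, (∀ j, MemLp (A j) 2 (volume.restrict Ω)) →
      (∀ j, MemLp (B j) 2 (volume.restrict Ω)) →
      ∫ x in Ω, ((A 0 x * starRingEnd ℂ (D₁ 1 x) - A 1 x * starRingEnd ℂ (D₁ 0 x))
      - (B 0 x * starRingEnd ℂ (D₂ 1 x) - B 1 x * starRingEnd ℂ (D₂ 0 x))) =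
      ((∫ x in Ω, A 0 x * starRingEnd ℂ (D₁ 1 x)) - ∫ x in Ω, A 1 x * starRingEnd ℂ (D₁ 0 x))
      - ((∫ x in Ω, B 0 x * starRingEnd ℂ (D₂ 1 x)) - ∫ x in Ω, B 1 x * starRingEnd ℂ (D₂ 0 x)) := by
    intro A B hA hB
    have i₁ := fun i j => integrable_mul_two (hA i) (s₁ j)
    have i₂ := fun i j => integrable_mul_two (hB i) (s₂ j)
    rw [← integral_sub (i₁ 0 1) (i₁ 1 0), ← integral_sub (i₂ 0 1) (i₂ 1 0),
      ← integral_sub (integrable_fun_sub (i₁ 0 1) (i₁ 1 0)) (integrable_fun_sub (i₂ 0 1) (i₂ 1 0))]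
  -- The truncated gradients converge to the true ones in `L²`, so the identity survives removing
  -- the truncation.
  have t₁ := fun i j => tendsto_integral_mul_of_eLpNorm (fun n => (h₁.truncAt n).memLp_deriv i)
    (h₁.memLp_deriv i) (s₁ j) (tendstoL2_fderiv_truncAt h₁.memLp.1 (h₁.memLp_deriv i))
  have t₂ := fun i j => tendsto_integral_mul_of_eLpNorm (fun n => (h₂.truncAt n).memLp_deriv i)
    (h₂.memLp_deriv i) (s₂ j) (tendstoL2_fderiv_truncAt h₂.memLp.1 (h₂.memLp_deriv i))
  rw [split D₁ D₂ h₁.memLp_deriv h₂.memLp_deriv]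
  refine tendsto_nhds_unique (((t₁ 0 1).sub (t₁ 1 0)).sub ((t₂ 0 1).sub (t₂ 1 0)))
    (tendsto_const_nhds.congr fun n => ?_)
  rw [← integral_truncated_area_eq hΩ h₁ h₂ hb n]
  exact split _ _ (h₁.truncAt n).memLp_deriv (h₂.truncAt n).memLp_deriv

/-! ### The divergence term and the boundary norm. -/

/-- The integrated Cauchy-Riemann derivative of `conj f₁ · f₂` when `conj f₁` is replaced by `p`
with gradient `P`. -/
lemma localForm_cauchyRiemann (hΩ : IsPiecewiseFlat Ω V) (hU : IsFlatPatch Ω U ν)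
    {p q : Plane → ℂ} {P : Fin 2 → Plane → ℂ} (hp : HasTrace Ω p P q)
    (h₂ : HasTrace Ω f₂ D₂ g₂) (hb : InfiniteMassPair Ω g₁ g₂)
    (hχ : ContDiff ℝ ∞ χ) (hc : HasCompactSupport χ) (hs : tsupport χ ⊆ U) :
    localForm Ω (fun x => -Complex.I * (P 0 x * f₂ x + p x * D₂ 0 x)
        - (P 1 x * f₂ x + p x * D₂ 1 x))
      ![fun x => -Complex.I * (p x * f₂ x), fun x => -(p x * f₂ x)]
      (fun x => q x * g₁ x) χ = 0 := by
  have hG := hp.gaussGreen_mul hΩ hU h₂ hχ hc hs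
  have i0 : ∀ j, Integrable (fun x => χ x * (P j x * f₂ x + p x * D₂ j x)) (volume.restrict Ω) :=
    fun j => integrable_continuous_mul ((integrable_mul_two (hp.memLp_deriv j) h₂.memLp).fun_add
      (integrable_mul_two hp.memLp (h₂.memLp_deriv j))) hχ.continuous hc
  have e0 : ∫ x in Ω, χ x * (-Complex.I * (P 0 x * f₂ x + p x * D₂ 0 x)
        - (P 1 x * f₂ x + p x * D₂ 1 x)) =
      -Complex.I * (∫ x in Ω, χ x * (P 0 x * f₂ x + p x * D₂ 0 x)) -
        ∫ x in Ω, χ x * (P 1 x * f₂ x + p x * D₂ 1 x) := by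
    rw [← integral_const_mul, ← integral_sub ((i0 0).const_mul _) (i0 1)]
    congr 1; funext x; ring
  have e1 : ∫ x in Ω, partialDeriv 0 χ x * (-Complex.I * (p x * f₂ x)) =
      -Complex.I * ∫ x in Ω, partialDeriv 0 χ x * (p x * f₂ x) := by
    rw [← integral_const_mul]; congr 1; funext x; ring
  have e2 : ∫ x in Ω, partialDeriv 1 χ x * -(p x * f₂ x) =
      - ∫ x in Ω, partialDeriv 1 χ x * (p x * f₂ x) := by
    rw [← integral_neg]; congr 1; funext x; ring
  -- The boundary condition is inverted: `(-i ν₀ - ν₁) · i (ν₀ + i ν₁) = ν₀² + ν₁² = 1`. Nothing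
  -- ties `q` to `g₁`, which leaves room for a truncated `p`.
  have e3 : ∫ x, χ x * (q x * g₁ x) ∂(boundaryMeasure Ω) =
      (-Complex.I * ν 0 - ν 1) * ∫ x, χ x * (q x * g₂ x) ∂(boundaryMeasure Ω) := by
    rw [← integral_const_mul]
    refine integral_congr_ae ?_
    filter_upwards [hb, ae_mem_frontier Ω] with x hx hxf
    by_cases hxU : x ∈ U
    · have hn := hU.normal x hxf hxU
      have h1 := norm_sq_eq_coord ν
      rw [hn.1, one_pow] at h1
      have h2 : (ν 0 : ℂ) ^ 2 + (ν 1 : ℂ) ^ 2 = 1 := by exact_mod_cast h1.symm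
      rw [hx ν hn]
      linear_combination (-χ x * q x * g₁ x) * h2 +
        (χ x * q x * g₁ x * ((ν 0 : ℂ) ^ 2 + Complex.I * ν 0 * ν 1 + ν 1 ^ 2)) * Complex.I_sq
    · simp [image_eq_zero_of_notMem_tsupport fun h => hxU (hs h)]
  simp only [localForm, Fin.sum_univ_two, Matrix.cons_val_zero, Matrix.cons_val_one, e0, e1, e2, e3]
  linear_combination -Complex.I * hG 0 - hG 1

lemma integral_cauchyRiemann_of_memLp (hΩ : IsPiecewiseFlat Ω V)
    {p q : Plane → ℂ} {P : Fin 2 → Plane → ℂ} (hp : HasTrace Ω p P q)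
    (h₁ : HasTrace Ω f₁ D₁ g₁) (h₂ : HasTrace Ω f₂ D₂ g₂) (hb : InfiniteMassPair Ω g₁ g₂)
    (k : MemLp (fun x => p x * f₂ x) 2 (volume.restrict Ω)) :
    ∫ x in Ω, (-Complex.I * (P 0 x * f₂ x + p x * D₂ 0 x) - (P 1 x * f₂ x + p x * D₂ 1 x)) =
      ∫ x, q x * g₁ x ∂(boundaryMeasure Ω) := by
  have i : ∀ j, Integrable (fun x => P j x * f₂ x + p x * D₂ j x) (volume.restrict Ω) := fun j =>
    (integrable_mul_two (hp.memLp_deriv j) h₂.memLp).fun_add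
      (integrable_mul_two hp.memLp (h₂.memLp_deriv j))
  exact hΩ.integral_eq_of_local
    (h := ![fun x => -Complex.I * (p x * f₂ x), fun x => -(p x * f₂ x)])
    (integrable_fun_sub ((i 0).const_mul _) (i 1))
    (Fin.forall_fin_two.2 ⟨k.const_mul (-Complex.I), k.neg⟩)
    (integrable_mul_two hp.memLp_trace h₁.memLp_trace)
    (fun U ν hU χ hχ hc hs => localForm_cauchyRiemann hΩ hU hp h₂ hb hχ hc hs)

/-- The boundary term of the mass. -/
lemma integral_cauchyRiemann (hΩ : IsPiecewiseFlat Ω V)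
    (h₁ : HasTrace Ω f₁ D₁ g₁) (h₂ : HasTrace Ω f₂ D₂ g₂) (hb : InfiniteMassPair Ω g₁ g₂) :
    ∫ x in Ω, (-Complex.I * (starRingEnd ℂ (D₁ 0 x) * f₂ x + starRingEnd ℂ (f₁ x) * D₂ 0 x)
        - (starRingEnd ℂ (D₁ 1 x) * f₂ x + starRingEnd ℂ (f₁ x) * D₂ 1 x)) =
      ∫ x, starRingEnd ℂ (g₁ x) * g₁ x ∂(boundaryMeasure Ω) := by
  have split : ∀ (p : Plane → ℂ) (P : Fin 2 → Plane → ℂ), MemLp p 2 (volume.restrict Ω) →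
      (∀ j, MemLp (P j) 2 (volume.restrict Ω)) →
      ∫ x in Ω, (-Complex.I * (P 0 x * f₂ x + p x * D₂ 0 x) - (P 1 x * f₂ x + p x * D₂ 1 x)) =
      -Complex.I * ((∫ x in Ω, P 0 x * f₂ x) + ∫ x in Ω, p x * D₂ 0 x)
        - ((∫ x in Ω, P 1 x * f₂ x) + ∫ x in Ω, p x * D₂ 1 x) := by
    intro p P hp hP
    have a := fun j => integrable_mul_two (hP j) h₂.memLp
    have b := fun j => integrable_mul_two hp (h₂.memLp_deriv j)
    rw [← integral_add (a 0) (b 0), ← integral_add (a 1) (b 1), ← integral_const_mul,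
      ← integral_sub (((a 0).fun_add (b 0)).const_mul _) ((a 1).fun_add (b 1))]
  have star : ∀ {μ : Measure Plane} {F : ℕ → Plane → ℂ} {f : Plane → ℂ}, TendstoL2 μ F f →
      TendstoL2 μ (fun n x => starRingEnd ℂ (F n x)) (fun x => starRingEnd ℂ (f x)) := fun h =>
    tendsto_eLpNorm_of_le (C := 1) h fun k x => by
      rw [← map_sub, one_mul, Complex.norm_conj]
  -- Taking `p` to be the conjugate of the truncated `f₁` makes `p f₂` square integrable.
  have hp := fun n => (h₁.truncAt n).conj
  have t := fun j => tendsto_integral_mul_of_eLpNorm (fun n => (hp n).memLp_deriv j)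
    (memLp_star (h₁.memLp_deriv j)) h₂.memLp
    (star (tendstoL2_fderiv_truncAt h₁.memLp.1 (h₁.memLp_deriv j)))
  have s := fun j => tendsto_integral_mul_of_eLpNorm (fun n => (hp n).memLp)
    (memLp_star h₁.memLp) (h₂.memLp_deriv j) (star (tendstoL2_truncAt h₁.memLp))
  have r := tendsto_integral_mul_of_eLpNorm (fun n => (hp n).memLp_trace)
    (memLp_star h₁.memLp_trace) h₁.memLp_trace (star (tendstoL2_truncAt h₁.memLp_trace))
  rw [split _ (fun j x => starRingEnd ℂ (D₁ j x)) (memLp_star h₁.memLp)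
    (fun j => memLp_star (h₁.memLp_deriv j))]
  refine tendsto_nhds_unique
    ((((t 0).add (s 0)).const_mul (-Complex.I)).sub ((t 1).add (s 1))) (r.congr fun n => ?_)
  have k : MemLp (fun x => starRingEnd ℂ (truncAt n (f₁ x)) * f₂ x) 2 (volume.restrict Ω) := by
    simpa using memLp_star (memLp_truncAt_mul h₁.memLp.1 (memLp_star h₂.memLp) n)
  rw [← integral_cauchyRiemann_of_memLp hΩ (hp n) h₁ h₂ hb k]
  exact split _ (fun j x => starRingEnd ℂ (fderiv ℝ (truncAt n) (f₁ x) (D₁ j x))) (hp n).memLp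
    (hp n).memLp_deriv

/-! ### The Dirac operator -/

variable {Ω V : Set Plane} {u g : Plane → Spinor}

lemma memLp_coord {μ : Measure Plane} (hu : MemLp u 2 μ) (i : Fin 2) :
    MemLp (fun x => u x i) 2 μ :=
  (EuclideanSpace.proj (𝕜 := ℂ) i : Spinor →L[ℂ] ℂ).comp_memLp' hu

lemma MemW12.memLp_weakPartial (hu : MemW12 Ω u) (j : Fin 2) :
    MemLp (weakPartial Ω j u) 2 (volume.restrict Ω) := by
  rw [weakPartial, dif_pos (hu.2 j)]
  exact (hu.2 j).choose_spec.1

lemma partialDeriv_coord {φ : Plane → Spinor} (hφ : ContDiff ℝ ∞ φ) (i j : Fin 2) (x : Plane) :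
    partialDeriv j (fun y => φ y i) x = partialDeriv j φ x i := by
  let A : Spinor →L[ℝ] ℂ := (EuclideanSpace.proj (𝕜 := ℂ) i : Spinor →L[ℂ] ℂ).restrictScalars ℝ
  have h : HasFDerivAt (fun y => φ y i) (A.comp (fderiv ℝ φ x)) x :=
    A.hasFDerivAt.comp x (hφ.differentiable (by simp) x).hasFDerivAt
  rw [partialDeriv, h.fderiv]
  rfl

lemma tendstoL2_coord {μ : Measure Plane} {φ : ℕ → Plane → Spinor}
    (h : Tendsto (fun k => eLpNorm (fun x => φ k x - u x) 2 μ) atTop (𝓝 0)) (i : Fin 2) :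
    TendstoL2 μ (fun k x => φ k x i) (fun x => u x i) :=
  tendsto_of_tendsto_of_tendsto_of_le_of_le tendsto_const_nhds h (fun _ => zero_le)
    fun k => eLpNorm_mono fun x => PiLp.norm_apply_le (φ k x - u x) i

/-- The reduction from spinors to scalar functions: the components of one approximating sequence
serve for each coordinate. -/
lemma IsTrace.hasTrace (h : IsTrace Ω u g) (i : Fin 2) :
    HasTrace Ω (fun x => u x i) (fun j x => weakPartial Ω j u x i) (fun x => g x i) := by
  obtain ⟨hu, hg, φ, hφ, h1, h2, h3⟩ := h
  refine ⟨memLp_coord hu.1 i, fun j => memLp_coord (hu.memLp_weakPartial j) i, memLp_coord hg i,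
    fun k x => φ k x i, fun k => ?_, tendstoL2_coord h1 i, fun j => ?_, tendstoL2_coord h3 i⟩
  · exact ((EuclideanSpace.proj (𝕜 := ℂ) i : Spinor →L[ℂ] ℂ).restrictScalars ℝ).contDiff.comp
      (hφ k)
  · have := tendstoL2_coord (h2 j) i
    simpa only [← partialDeriv_coord (hφ _)] using this

lemma norm_sq_spinor (v : Spinor) : ‖v‖ ^ 2 = ‖v 0‖ ^ 2 + ‖v 1‖ ^ 2 := by
  rw [EuclideanSpace.norm_sq_eq]; simp [Fin.sum_univ_two]

/-- The pointwise expansion of `|Tu|²`. -/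
lemma norm_dirac_sq (m : ℝ) (x : Plane) :
    ‖dirac Ω m u x‖ ^ 2 = (‖weakPartial Ω 0 u x‖ ^ 2 + ‖weakPartial Ω 1 u x‖ ^ 2
      + m ^ 2 * ‖u x‖ ^ 2)
      + (2 * m * (-Complex.I * (starRingEnd ℂ (weakPartial Ω 0 u x 0) * u x 1
          + starRingEnd ℂ (u x 0) * weakPartial Ω 0 u x 1)
        - (starRingEnd ℂ (weakPartial Ω 1 u x 0) * u x 1
          + starRingEnd ℂ (u x 0) * weakPartial Ω 1 u x 1)).re
      + ((weakPartial Ω 0 u x 0 * starRingEnd ℂ (weakPartial Ω 1 u x 0)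
          - weakPartial Ω 1 u x 0 * starRingEnd ℂ (weakPartial Ω 0 u x 0))
        - (weakPartial Ω 0 u x 1 * starRingEnd ℂ (weakPartial Ω 1 u x 1)
          - weakPartial Ω 1 u x 1 * starRingEnd ℂ (weakPartial Ω 0 u x 1))).im) := by
  simp only [norm_sq_spinor, dirac, Matrix.cons_val_zero, Matrix.cons_val_one,
    Complex.sq_norm, Complex.normSq_apply]
  generalize weakPartial Ω 0 u x 0 = a
  generalize weakPartial Ω 0 u x 1 = b
  generalize weakPartial Ω 1 u x 0 = c
  generalize weakPartial Ω 1 u x 1 = d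
  simp only [Complex.add_re, Complex.sub_re, Complex.mul_re, Complex.neg_re, Complex.I_re,
    Complex.I_im, Complex.ofReal_re, Complex.ofReal_im, Complex.add_im, Complex.sub_im,
    Complex.mul_im, Complex.neg_im, Complex.conj_re, Complex.conj_im]
  ring

lemma InfiniteMassCondition.congr {g' : Plane → Spinor} (h : InfiniteMassCondition Ω g)
    (h0 : ∀ i, (fun x => g x i) =ᵐ[boundaryMeasure Ω] fun x => g' x i) :
    InfiniteMassPair Ω (fun x => g' x 0) (fun x => g' x 1) := by
  filter_upwards [h, h0 0, h0 1] with x h1 h2 h3 ν hν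
  rw [← h2, ← h3]
  exact h1 ν hν

/-- Under the infinite-mass condition both components of the trace have the same modulus. -/
lemma InfiniteMassPair.normSqL2_eq (hΩ : IsPiecewiseFlat Ω V)
    (h : InfiniteMassPair Ω (fun x => g x 0) (fun x => g x 1)) :
    normSqL2 (boundaryMeasure Ω) g = 2 * (∫ x, starRingEnd ℂ (g x 0) * g x 0
      ∂(boundaryMeasure Ω)).re := by
  have e : ∀ x, starRingEnd ℂ (g x 0) * g x 0 = ((‖g x 0‖ ^ 2 : ℝ) : ℂ) := fun x => by
    rw [Complex.conj_mul']; simp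
  simp only [e]
  rw [integral_complex_ofReal, Complex.ofReal_re, normSqL2, ← integral_const_mul]
  refine integral_congr_ae (hΩ.ae_boundary_of_patch fun U ν hU => ?_)
  filter_upwards [h, ae_mem_frontier Ω] with x hx hxf hxU
  have hn := hU.normal x hxf hxU
  rw [norm_sq_spinor, hx ν hn, norm_mul, norm_infiniteMassFactor hn.1]
  ring

/-- Integrate the pointwise expansion. The area difference contributes zero, and `2m ∫ |g₁|²` is `m`
times the full boundary norm because `|g₂| = |g₁|`. The sign of `m` plays no role. -/
theorem IsPiecewiseFlat.normSqL2_dirac (hΩ : IsPiecewiseFlat Ω V) (m : ℝ) (hg : IsTrace Ω u g)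
    (hb : InfiniteMassPair Ω (fun x => g x 0) (fun x => g x 1)) :
    normSqL2 (volume.restrict Ω) (dirac Ω m u) =
      (normSqL2 (volume.restrict Ω) (weakPartial Ω 0 u)
        + normSqL2 (volume.restrict Ω) (weakPartial Ω 1 u))
      + m ^ 2 * normSqL2 (volume.restrict Ω) u + m * normSqL2 (boundaryMeasure Ω) g := by
  have h₁ := hg.hasTrace 0
  have h₂ := hg.hasTrace 1
  have s₁ := h₁.conj
  have s₂ := h₂.conj
  have iW := fun j => ((hg.1.memLp_weakPartial j).norm).integrable_sq
  have iu := hg.1.1.norm.integrable_sq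
  have iE : Integrable (fun x => -Complex.I * (starRingEnd ℂ (weakPartial Ω 0 u x 0) * u x 1
          + starRingEnd ℂ (u x 0) * weakPartial Ω 0 u x 1)
        - (starRingEnd ℂ (weakPartial Ω 1 u x 0) * u x 1
          + starRingEnd ℂ (u x 0) * weakPartial Ω 1 u x 1)) (volume.restrict Ω) := by
    have i := fun j => (integrable_mul_two (s₁.memLp_deriv j) h₂.memLp).fun_add
      (integrable_mul_two s₁.memLp (h₂.memLp_deriv j))
    exact integrable_fun_sub ((i 0).const_mul _) (i 1)
  have iA : Integrable (fun x =>
      (weakPartial Ω 0 u x 0 * starRingEnd ℂ (weakPartial Ω 1 u x 0)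
          - weakPartial Ω 1 u x 0 * starRingEnd ℂ (weakPartial Ω 0 u x 0))
        - (weakPartial Ω 0 u x 1 * starRingEnd ℂ (weakPartial Ω 1 u x 1)
          - weakPartial Ω 1 u x 1 * starRingEnd ℂ (weakPartial Ω 0 u x 1)))
      (volume.restrict Ω) := by
    have i₁ := fun i j => integrable_mul_two (h₁.memLp_deriv i) (s₁.memLp_deriv j)
    have i₂ := fun i j => integrable_mul_two (h₂.memLp_deriv i) (s₂.memLp_deriv j)
    exact integrable_fun_sub (integrable_fun_sub (i₁ 0 1) (i₁ 1 0))
      (integrable_fun_sub (i₂ 0 1) (i₂ 1 0))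
  have kE := Complex.reCLM.integral_comp_comm iE
  have kA := Complex.imCLM.integral_comp_comm iA
  rw [integral_cauchyRiemann hΩ h₁ h₂ hb] at kE
  rw [integral_area_eq hΩ h₁ h₂ hb] at kA
  simp only [Complex.reCLM_apply, Complex.imCLM_apply, Complex.zero_im] at kE kA
  have jE := Complex.reCLM.integrable_comp iE
  have jA := Complex.imCLM.integrable_comp iA
  simp only [Complex.reCLM_apply, Complex.imCLM_apply] at jE jA
  rw [hb.normSqL2_eq hΩ]
  simp only [normSqL2, norm_dirac_sq]
  rw [integral_add (((iW 0).fun_add (iW 1)).fun_add (iu.const_mul (m ^ 2)))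
      ((jE.const_mul (2 * m)).fun_add jA),
    integral_add ((iW 0).fun_add (iW 1)) (iu.const_mul (m ^ 2)), integral_add (iW 0) (iW 1),
    integral_add (jE.const_mul (2 * m)) jA, integral_const_mul, integral_const_mul, kE, kA]
  ring

end PolygonDirac

end

theorem mainTheorem8 (Ω : Set PolygonDirac.Plane) (hΩ : PolygonDirac.IsPolygon Ω)
    (m : ℝ) (hm : 0 ≤ m)
    (u : PolygonDirac.Plane → PolygonDirac.Spinor) (hu : u ∈ PolygonDirac.diracDomain Ω)
    (γu : PolygonDirac.Plane → PolygonDirac.Spinor) (hγ : PolygonDirac.IsTrace Ω u γu) :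
    PolygonDirac.normSqL2 (volume.restrict Ω) (PolygonDirac.dirac Ω m u) =
      (PolygonDirac.normSqL2 (volume.restrict Ω) (PolygonDirac.weakPartial Ω 0 u)
        + PolygonDirac.normSqL2 (volume.restrict Ω) (PolygonDirac.weakPartial Ω 1 u))
      + m ^ 2 * PolygonDirac.normSqL2 (volume.restrict Ω) u
      + m * PolygonDirac.normSqL2 (PolygonDirac.boundaryMeasure Ω) γu := by
  obtain ⟨V, hV⟩ := hΩ.exists_isPiecewiseFlat
  obtain ⟨-, g, hg, hb⟩ := hu
  -- Membership in the domain provides some trace satisfying the boundary condition; uniqueness of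
  -- the trace transfers the condition to `γu`.
  exact hV.normSqL2_dirac m hγ
    (hb.congr fun i => (hg.hasTrace i).ae_eq hV (hγ.hasTrace i))
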